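/- **Setting.** Let $p\ge 1$ be the dimension and $\phi$ the $N_p(0,I_p)$ density. For a probability law $G$ on $(0,\infty)$ with $\int v^{-p/2}\,dG(v)<\infty$ (a *mixing law*), write $g\sim SN_p(G)$ if $g(x)=\int \phi(x/v^{1/2})\,v^{-p/2}\,dG(v)$ for $x\in\mathbb{R}^p$. Let $p(\cdot)\sim SN_p(G)$ and $q\sim SN_p(H)$ with mixing laws $G,H$. For unknown $\mu\in\mathbb{R}^p$ one observes $X$ with density $p(x-\mu)$ and estimates the density $q(y-\mu)$, $y\in\mathbb{R}^p$, by a predictive density estimator $\hat q(y;X)$, with $L_2$ risk $$R(\mu,\hat q)=\int_{\mathbb{R}^p}\Big\{\int_{\mathbb{R}^p}|q(y-\mu)-\hat q(y;x)|^2\,dy\Big\}\,p(x-\mu)\,dx .$$ The risk of a point estimator $\hat\mu(X)$ under a loss $L(\mu,\hat\mu)$ is $E_\mu[L(\mu,\hat\mu(X))]$; point estimators are measurable maps $\mathbb{R}^p\to\mathbb{R}^p$. In either problem, one estimator *dominates* another if its risk is $\le$ for every $\mu$ and $<$ for at least one $\mu$. An estimator $\hat q$ is *inadmissible* if some predictive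 density estimator dominates it. It is *minimum risk equivariant* (MRE) if $\hat q(y+a;x+a)=\hat q(y;x)$ for all $a,x,y$ and its risk is, for every $\mu$, minimal among the predictive density estimators with this equivariance property. Let $V_1\sim G$ and $W_1,W_2\sim H$ be independent, and let $F$ and $J$ be the laws of $V_1+W_1$ and $V_1+W_1+W_2$. Let $F_Z$ be the law of $$Z=\frac{Z_1Z_2}{Z_1+Z_2},\qquad (Z_1,Z_2)\sim\tau,\qquad d\tau(z_1,z_2)\propto\frac{1}{z_2\,(z_1+z_2)^{p/2}}\,dG(z_1)\,dJ(z_2),$$ $\tau$ being normalized to a probability measure. **Theorem.** The convolution satisfies $q*p\sim SN_p(F)$, the estimator $q*p(y-X)$ is MRE, and $F_Z$ is a well-defined mixing law. Moreover: (a) For every point estimator $\hat\mu$ and every constant $K\in\mathbb{R}$, the estimator $q*p(y-\hat\mu(X))$ dominates the MRE estimator $q*p(y-X)$ if and only if $\hat\mu(X)$ dominates $X$ as a point estimator of $\mu$, for $X\sim p(x-\mu)$, under the loss $$f(\|\hat\mu-\mu\|^2)=K-\int (2\pi t)^{-p/2}\,e^{-\|\hat\mu-\mu\|^2/(2t)}\,dJ(t).$$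 (b) For every point estimator $\hat\mu$, the estimator $q*p(y-\hat\mu(X))$ dominates the MRE estimator $q*p(y-X)$ whenever $\hat\mu(X')$ dominates $X'$ under squared-error loss $\|\hat\mu-\mu\|^2$ in the model $X'-\mu\sim SN_p(F_Z)$. (c) Let $p\ge 3$ and suppose that $E(Z)$ and $E(Z^{-1})$ are finite. Then the MRE estimator $q*p(y-X)$ is inadmissible. It is dominated by $q*p(y-\hat\mu_{a,r}(X))$, where $$\hat\mu_{a,r}(X)=\Big(1-a\,\frac{r(X'X)}{X'X}\Big)X ,$$ for every function $r$ on $(0,\infty)$ that is nondecreasing, has $r(t)/t$ nonincreasing, satisfies $0\le r\le 1$ and is not identically zero, and for every $a$ with $0<a\le \dfrac{2(p-2)}{E(Z^{-1})}$. (Here, as usual, $X'X=\|X\|^2$.) -/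

import Mathlib

open MeasureTheory

noncomputable section

namespace PredDensity

/-- The sample space `ℝᵈ` with its Euclidean norm. -/
abbrev Vec (d : ℕ) : Type := EuclideanSpace ℝ (Fin d)

/-- The density `φ` of the standard normal distribution `N_d(0, I_d)`. -/
def stdNormalDensity (d : ℕ) (x : Vec d) : ℝ :=
  (2 * Real.pi) ^ (-((d : ℝ) / 2)) * Real.exp (-(‖x‖ ^ 2 / 2))

/-- `G` is an admissible mixing distribution for scale mixtures of normals in dimension `d`: the law
of a random variable `V > 0` with `E (V ^ (-d/2)) < ∞`. -/
structure IsMixing (d : ℕ) (G : Measure ℝ) : Prop where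
  isProb : IsProbabilityMeasure G
  pos : ∀ᵐ v ∂G, 0 < v
  moment : Integrable (fun v : ℝ => v ^ (-((d : ℝ) / 2))) G

/-- The function `x ↦ ∫ φ(x / v^{1/2}) v^{-d/2} dG(v)`. -/
def snDensity (d : ℕ) (G : Measure ℝ) (x : Vec d) : ℝ :=
  ∫ v, stdNormalDensity d ((Real.sqrt v)⁻¹ • x) * v ^ (-((d : ℝ) / 2)) ∂G

/-- `p ∼ SN_d(G)`: `p` is the scale mixture of normals density with mixing distribution `G`. -/
def IsSN {d : ℕ} (p : Vec d → ℝ) (G : Measure ℝ) : Prop :=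
  IsMixing d G ∧ p = snDensity d G

/-- The law on `ℝᵈ` with density `x ↦ p (x - μ)`. -/
def locLaw {d : ℕ} (p : Vec d → ℝ) (μ : Vec d) : Measure (Vec d) :=
  volume.withDensity (fun x => ENNReal.ofReal (p (x - μ)))

/-- The convolution `(f * g)(t) = ∫ f(u) g(t - u) du` of two functions on `ℝᵈ`. -/
def convDensity {d : ℕ} (f g : Vec d → ℝ) : Vec d → ℝ :=
  convolution f g (ContinuousLinearMap.mul ℝ ℝ) volume

/-- A risk function `R₁` dominates a risk function `R₂`: it is nowhere larger, and smaller for at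
least one parameter value. -/
def Dominates {Θ α : Type*} [Preorder α] (R₁ R₂ : Θ → α) : Prop :=
  (∀ θ, R₁ θ ≤ R₂ θ) ∧ ∃ θ, R₁ θ < R₂ θ

/-! ### Predictive density estimation under integrated squared error -/

/-- A predictive density estimator `(x, y) ↦ qhat x y`: for each observation `x` it is a probability
density in `y`. -/
structure IsPredictiveDensity {d : ℕ} (qhat : Vec d → Vec d → ℝ) : Prop where
  measurable : Measurable (Function.uncurry qhat)
  nonneg : ∀ x y, 0 ≤ qhat x y
  integral_eq_one : ∀ x, ∫ y, qhat x y = 1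

/-- The loss `∫ |q(y - μ) - g(y)|² dy` of the estimate `g`. -/
def l2Loss {d : ℕ} (q : Vec d → ℝ) (μ : Vec d) (g : Vec d → ℝ) : ENNReal :=
  ∫⁻ y, ENNReal.ofReal (|q (y - μ) - g y| ^ 2)

/-- The frequentist risk of `qhat` when `X ∼ p(x - μ)` and `q(y - μ)` is to be estimated. -/
def l2Risk {d : ℕ} (p q : Vec d → ℝ) (qhat : Vec d → Vec d → ℝ) (μ : Vec d) : ENNReal :=
  ∫⁻ x, l2Loss q μ (qhat x) ∂(locLaw p μ)

/-- The estimator `f(y - muhat(x))`. -/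
def plugIn {d : ℕ} (f : Vec d → ℝ) (muhat : Vec d → Vec d) : Vec d → Vec d → ℝ :=
  fun x y => f (y - muhat x)

/-- `qhat` is inadmissible: another predictive density estimator dominates it. -/
def Inadmissible {d : ℕ} (p q : Vec d → ℝ) (qhat : Vec d → Vec d → ℝ) : Prop :=
  ∃ qt : Vec d → Vec d → ℝ, IsPredictiveDensity qt ∧ Dominates (l2Risk p q qt) (l2Risk p q qhat)

/-- Equivariance under the changes of location `(x, y) ↦ (x + a, y + a)`. -/
def IsEquivariant {d : ℕ} (qhat : Vec d → Vec d → ℝ) : Prop :=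
  ∀ a x y, qhat (x + a) (y + a) = qhat x y

/-- `qhat` is a minimum risk equivariant (MRE) predictive density estimator. -/
def IsMRE {d : ℕ} (p q : Vec d → ℝ) (qhat : Vec d → Vec d → ℝ) : Prop :=
  IsPredictiveDensity qhat ∧ IsEquivariant qhat ∧
    ∀ qt : Vec d → Vec d → ℝ, IsPredictiveDensity qt → IsEquivariant qt →
      ∀ μ, l2Risk p q qhat μ ≤ l2Risk p q qt μ

/-! ### Point estimation -/

/-- The risk `E_μ [ℓ(‖muhat(X) - μ‖²)]`, `X ∼ p(x - μ)`, of the point estimator `muhat`, as the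
extended real number `E [ℓ⁺] - E [ℓ⁻]` (meaningful for every `ℓ` that is bounded below). -/
def pointRisk {d : ℕ} (p : Vec d → ℝ) (ℓ : ℝ → ℝ) (muhat : Vec d → Vec d) (μ : Vec d) : EReal :=
  ((∫⁻ x, ENNReal.ofReal (ℓ (‖muhat x - μ‖ ^ 2)) ∂(locLaw p μ) : ENNReal) : EReal) -
    ((∫⁻ x, ENNReal.ofReal (-ℓ (‖muhat x - μ‖ ^ 2)) ∂(locLaw p μ) : ENNReal) : EReal)

/-- The reflected scale mixture of normals loss
`f(s) = K - ∫ (2πt)^{-d/2} exp(-s/(2t)) dJ(t)`, as a function of `s = ‖muhat - μ‖²`. -/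
def reflectedLoss (d : ℕ) (J : Measure ℝ) (K : ℝ) (s : ℝ) : ℝ :=
  K - ∫ t, (2 * Real.pi * t) ^ (-((d : ℝ) / 2)) * Real.exp (-(s / (2 * t))) ∂J

/-- The Baranchik type estimator `(1 - a r(x'x) / (x'x)) x`. -/
def baranchik {d : ℕ} (a : ℝ) (r : ℝ → ℝ) (x : Vec d) : Vec d :=
  (1 - a * (r (‖x‖ ^ 2) / ‖x‖ ^ 2)) • x

/-! ### The mixing distributions -/

/-- The law `F` of `V₁ + W₁`, where `V₁ ∼ G` and `W₁ ∼ H` are independent. -/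
def mixF (G H : Measure ℝ) : Measure ℝ :=
  (G.prod H).map (fun z => z.1 + z.2)

/-- The law `J` of `V₁ + W₁ + W₂`, where `V₁ ∼ G`, `W₁ ∼ H`, `W₂ ∼ H` are independent. -/
def mixJ (G H : Measure ℝ) : Measure ℝ :=
  (G.prod (H.prod H)).map (fun z => z.1 + z.2.1 + z.2.2)

/-- The unnormalized weight `1 / (z₂ (z₁ + z₂)^{d/2})`. -/
def tauWeight (d : ℕ) (z : ℝ × ℝ) : ENNReal :=
  ENNReal.ofReal (1 / (z.2 * (z.1 + z.2) ^ ((d : ℝ) / 2)))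

/-- The law `τ` of `(Z₁, Z₂)`: the normalization to total mass one of
`1 / (z₂ (z₁ + z₂)^{d/2}) dG(z₁) dJ(z₂)`. -/
def tau (d : ℕ) (G H : Measure ℝ) : Measure (ℝ × ℝ) :=
  (∫⁻ z, tauWeight d z ∂(G.prod (mixJ G H)))⁻¹ • (G.prod (mixJ G H)).withDensity (tauWeight d)

/-- The law `F_Z` of `Z = Z₁ Z₂ / (Z₁ + Z₂)`, where `(Z₁, Z₂) ∼ τ`. -/
def mixZ (d : ℕ) (G H : Measure ℝ) : Measure ℝ :=
  (tau d G H).map (fun z => z.1 * z.2 / (z.1 + z.2))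

end PredDensity

end

open PredDensity

/-!
Scale mixtures of normal densities convolve by convolving their mixing distributions, so `q * p`
and `q * q * p` are the scale mixtures with mixing distributions `F` and `J`
(`integral_snDensity_mul_sub`). Expanding the square, the risk of the plug-in estimator `q * p (y
- muhat(X))` is therefore a constant minus twice the expectation of `(q * q * p)(muhat(X) - μ)`
(`overlap`, `l2Risk_plugIn`), and the risk of `muhat` under the reflected loss is `K` minus the
same expectation; this is (a). An equivariant estimator is `g(y - x)`, and exchanging the order of
integration reduces its risk to a family of problems of approximating a random variable by a
constant, solved by the mean, which is `q * p` (`isMRE_plugIn`).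

For (b), the function `s ↦ ∫ (2πt)^{-d/2} exp(-s/(2t)) dJ(t)` is strictly convex, so that the gain
of `muhat` over `X` is bounded below by its linearization at `s = ‖X - μ‖²`. The slope there,
multiplied by the density of `X`, is proportional to the `SN(F_Z)` density, because the product of
two centred normal densities is a multiple of a third one (`snDensity_mul_lossSlope`). Hence the
lower bound is a positive multiple of the gain in squared error risk in the `SN(F_Z)` model, and
it is strict unless `muhat(X)` and `X` are almost surely equally far from `μ`
(`overlap_le_of_sq_risk_le`).

For (c), it remains to compare squared error risks. Conditionally on the variance `v`, the scale
derivative of the normal density gives the inequality that Stein's identity gives for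
differentiable `r` (`stein_shrink_le`). The bound on the risk difference is then `M(v) (a / v - 2
(d - 2))`, up to a positive factor, with `M` nondecreasing (`mul_integral_shrink_mono`, from a
reflection argument); since the other factor decreases in `v`, integrating over `v` leaves at most
a nonnegative multiple of `a E(Z⁻¹) - 2 (d - 2) ≤ 0` (`lintegral_baranchik_le`). At the largest
admissible `a` the two squared error risks can coincide, as for the James–Stein estimator and a
normal law; strict domination in the predictive problem comes from the strict convexity used in
(b).
-/

noncomputable section

namespace PredDensity

open Real

/-! ### The Gaussian kernel -/

/-- The `N_d(0, v I_d)` density as a function of the variance `v` and of the squared norm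
`s = ‖x‖ ^ 2`. -/
def gaussK (d : ℕ) (v s : ℝ) : ℝ :=
  (2 * π * v) ^ (-((d : ℝ) / 2)) * exp (-(s / (2 * v)))

lemma gaussK_pos (d : ℕ) {v : ℝ} (hv : 0 < v) (s : ℝ) : 0 < gaussK d v s := by
  unfold gaussK; positivity

lemma gaussK_eq_mul (d : ℕ) {v : ℝ} (hv : 0 < v) (s : ℝ) :
    gaussK d v s =
      (2 * π) ^ (-((d : ℝ) / 2)) * (v ^ (-((d : ℝ) / 2)) * exp (-(s / (2 * v)))) := by
  rw [gaussK, mul_rpow (by positivity) hv.le, mul_assoc]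

lemma gaussK_le (d : ℕ) {v s : ℝ} (hv : 0 < v) (hs : 0 ≤ s) :
    gaussK d v s ≤ (2 * π) ^ (-((d : ℝ) / 2)) * v ^ (-((d : ℝ) / 2)) := by
  rw [gaussK_eq_mul d hv]
  have h : exp (-(s / (2 * v))) ≤ 1 := by
    rw [exp_le_one_iff]; have : 0 ≤ s / (2 * v) := by positivity
    linarith
  have h2 : 0 ≤ v ^ (-((d : ℝ) / 2)) := by positivity
  gcongr
  exact mul_le_of_le_one_right h2 h

lemma measurable_gaussK (d : ℕ) : Measurable (fun z : ℝ × ℝ => gaussK d z.1 z.2) := by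
  unfold gaussK
  fun_prop

@[fun_prop]
lemma Measurable.gaussK {α : Type*} [MeasurableSpace α] {f g : α → ℝ} (d : ℕ)
    (hf : Measurable f) (hg : Measurable g) : Measurable (fun a => gaussK d (f a) (g a)) :=
  (measurable_gaussK d).comp (hf.prodMk hg)

lemma snDensity_eq {d : ℕ} {G : Measure ℝ} (hG : ∀ᵐ v ∂G, 0 < v) (x : Vec d) :
    snDensity d G x = ∫ v, gaussK d v (‖x‖ ^ 2) ∂G := by
  refine integral_congr_ae ?_
  filter_upwards [hG] with v hv
  rw [gaussK_eq_mul d hv, stdNormalDensity, norm_smul, mul_pow, norm_inv, inv_pow,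
    Real.norm_of_nonneg (sqrt_nonneg v), sq_sqrt hv.le]
  have : (v⁻¹ * ‖x‖ ^ 2 / 2) = ‖x‖ ^ 2 / (2 * v) := by field_simp
  rw [this]; ring

lemma IsMixing.integrable_gaussK {d : ℕ} {G : Measure ℝ} (hG : IsMixing d G) {s : ℝ}
    (hs : 0 ≤ s) : Integrable (fun v => gaussK d v s) G := by
  refine (hG.moment.const_mul ((2 * π) ^ (-((d : ℝ) / 2)))).mono'
    (measurable_id.gaussK d measurable_const).aestronglyMeasurable ?_
  filter_upwards [hG.pos] with v hv
  rw [Real.norm_of_nonneg (gaussK_pos d hv s).le]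
  exact gaussK_le d hv hs

lemma gaussK_mul (d : ℕ) {a b : ℝ} (ha : 0 < a) (hb : 0 < b) (s : ℝ) :
    gaussK d a s * gaussK d b s =
      (2 * π * (a + b)) ^ (-((d : ℝ) / 2)) * gaussK d (a * b / (a + b)) s := by
  have h1 : (2 * π * a) ^ (-((d : ℝ) / 2)) * (2 * π * b) ^ (-((d : ℝ) / 2)) =
      (2 * π * (a + b)) ^ (-((d : ℝ) / 2)) * (2 * π * (a * b / (a + b))) ^ (-((d : ℝ) / 2)) := by
    rw [← mul_rpow (by positivity) (by positivity), ← mul_rpow (by positivity) (by positivity)]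
    congr 1; field_simp
  have h2 : exp (-(s / (2 * a))) * exp (-(s / (2 * b))) =
      exp (-(s / (2 * (a * b / (a + b))))) := by
    rw [← exp_add]; congr 1; field_simp; ring
  unfold gaussK
  rw [← h2]
  linear_combination (exp (-(s / (2 * a))) * exp (-(s / (2 * b)))) * h1

/-- Completing the square. -/
lemma gaussK_mul_sub {d : ℕ} {a b : ℝ} (ha : 0 < a) (hb : 0 < b) (x y : Vec d) :
    gaussK d a (‖x‖ ^ 2) * gaussK d b (‖y - x‖ ^ 2) =
      gaussK d (a * b / (a + b)) (‖x - (a / (a + b)) • y‖ ^ 2) * gaussK d (a + b) (‖y‖ ^ 2) := by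
  have h1 : (2 * π * a) ^ (-((d : ℝ) / 2)) * (2 * π * b) ^ (-((d : ℝ) / 2)) =
      (2 * π * (a * b / (a + b))) ^ (-((d : ℝ) / 2)) * (2 * π * (a + b)) ^ (-((d : ℝ) / 2)) := by
    rw [← mul_rpow (by positivity) (by positivity), ← mul_rpow (by positivity) (by positivity)]
    congr 1; field_simp
  have h2 : exp (-(‖x‖ ^ 2 / (2 * a))) * exp (-(‖y - x‖ ^ 2 / (2 * b))) =
      exp (-(‖x - (a / (a + b)) • y‖ ^ 2 / (2 * (a * b / (a + b))))) *
        exp (-(‖y‖ ^ 2 / (2 * (a + b)))) := by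
    rw [← exp_add, ← exp_add]; congr 1
    rw [norm_sub_sq_real, norm_sub_sq_real, norm_smul, inner_smul_right, real_inner_comm,
      Real.norm_of_nonneg (by positivity)]
    field_simp; ring
  unfold gaussK
  linear_combination (exp (-(‖x‖ ^ 2 / (2 * a))) * exp (-(‖y - x‖ ^ 2 / (2 * b)))) * h1 +
    ((2 * π * (a * b / (a + b))) ^ (-((d : ℝ) / 2)) * (2 * π * (a + b)) ^ (-((d : ℝ) / 2))) * h2

/-- Polar coordinates reduce the claim to a Gamma integral on the half-line. -/
lemma integrable_norm_rpow_mul_exp {d : ℕ} (hd : 1 ≤ d) {k b : ℝ} (hk : 0 < d + k) (hb : 0 < b) :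
    Integrable (fun x : Vec d => ‖x‖ ^ k * exp (-b * ‖x‖ ^ 2)) := by
  have : Nonempty (Fin d) := ⟨⟨0, hd⟩⟩
  rw [integrable_fun_norm_addHaar volume (f := fun t : ℝ => t ^ k * exp (-b * t ^ 2))]
  refine (integrableOn_rpow_mul_exp_neg_mul_sq hb (s := d + k - 1) (by linarith)).congr_fun ?_
    measurableSet_Ioi
  intro t ht
  have ht : 0 < t := ht
  simp only [finrank_euclideanSpace, Fintype.card_fin, smul_eq_mul]
  rw [← mul_assoc, ← rpow_natCast t (d - 1), ← rpow_add ht, Nat.cast_sub hd, Nat.cast_one]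
  congr 2; ring

lemma integrable_norm_rpow_mul_gaussK {d : ℕ} (hd : 1 ≤ d) {k v : ℝ} (hk : 0 < d + k)
    (hv : 0 < v) : Integrable (fun x : Vec d => ‖x‖ ^ k * gaussK d v (‖x‖ ^ 2)) := by
  refine ((integrable_norm_rpow_mul_exp hd hk (b := 1 / (2 * v)) (by positivity)).const_mul
    ((2 * π * v) ^ (-((d : ℝ) / 2)))).congr (Filter.Eventually.of_forall fun x => ?_)
  simp only [gaussK]
  rw [show -(1 / (2 * v)) * ‖x‖ ^ 2 = -(‖x‖ ^ 2 / (2 * v)) by ring]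
  ring

lemma integrable_gaussK_norm_sq {d : ℕ} (hd : 1 ≤ d) {v : ℝ} (hv : 0 < v) :
    Integrable (fun x : Vec d => gaussK d v (‖x‖ ^ 2)) := by
  simpa using integrable_norm_rpow_mul_gaussK hd (k := 0) (by simpa using Nat.pos_of_ne_zero (by omega)) hv

lemma integral_gaussK {d : ℕ} {v : ℝ} (hv : 0 < v) : ∫ x : Vec d, gaussK d v (‖x‖ ^ 2) = 1 := by
  have h := GaussianFourier.integral_rexp_neg_mul_sq_norm (V := Vec d) (b := 1 / (2 * v))
    (by positivity)
  have h2 : ∀ x : Vec d, gaussK d v (‖x‖ ^ 2) =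
      (2 * π * v) ^ (-((d : ℝ) / 2)) * exp (-(1 / (2 * v)) * ‖x‖ ^ 2) := by
    intro x; rw [gaussK]; congr 2; ring
  simp_rw [h2]
  rw [integral_const_mul, h, finrank_euclideanSpace, Fintype.card_fin,
    show π / (1 / (2 * v)) = 2 * π * v by field_simp, ← rpow_add (by positivity)]
  simp

lemma lintegral_gaussK {d : ℕ} (hd : 1 ≤ d) {v : ℝ} (hv : 0 < v) :
    ∫⁻ x : Vec d, ENNReal.ofReal (gaussK d v (‖x‖ ^ 2)) = 1 := by
  rw [← ofReal_integral_eq_lintegral_ofReal (integrable_gaussK_norm_sq hd hv)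
    (Filter.Eventually.of_forall fun x => (gaussK_pos d hv _).le), integral_gaussK hv,
    ENNReal.ofReal_one]

/-- The `N_d(0, a I_d)` and `N_d(0, b I_d)` densities convolve to the `N_d(0, (a + b) I_d)`
density. -/
lemma lintegral_gaussK_mul_sub {d : ℕ} (hd : 1 ≤ d) {a b : ℝ} (ha : 0 < a) (hb : 0 < b)
    (y : Vec d) :
    ∫⁻ x : Vec d, ENNReal.ofReal (gaussK d a (‖x‖ ^ 2)) * ENNReal.ofReal (gaussK d b (‖y - x‖ ^ 2))
      = ENNReal.ofReal (gaussK d (a + b) (‖y‖ ^ 2)) := by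
  have hab : 0 < a * b / (a + b) := by positivity
  have h : ∀ x : Vec d, ENNReal.ofReal (gaussK d a (‖x‖ ^ 2)) *
      ENNReal.ofReal (gaussK d b (‖y - x‖ ^ 2)) =
      ENNReal.ofReal (gaussK d (a * b / (a + b)) (‖x - (a / (a + b)) • y‖ ^ 2)) *
        ENNReal.ofReal (gaussK d (a + b) (‖y‖ ^ 2)) := by
    intro x
    rw [← ENNReal.ofReal_mul (gaussK_pos d ha _).le, gaussK_mul_sub ha hb,
      ENNReal.ofReal_mul (gaussK_pos d hab _).le]
  simp_rw [h]
  rw [lintegral_mul_const _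
    (measurable_const.gaussK d (by fun_prop) : Measurable _).ennreal_ofReal]
  rw [lintegral_sub_right_eq_self
    (fun x : Vec d => ENNReal.ofReal (gaussK d (a * b / (a + b)) (‖x‖ ^ 2))),
    lintegral_gaussK hd hab, one_mul]

/-! ### Scale mixtures of normal densities -/

section Mixture

variable {d : ℕ} {G A B : Measure ℝ}

lemma ofReal_snDensity (hG : IsMixing d G) (x : Vec d) :
    ENNReal.ofReal (snDensity d G x) = ∫⁻ v, ENNReal.ofReal (gaussK d v (‖x‖ ^ 2)) ∂G := by
  rw [snDensity_eq hG.pos, ofReal_integral_eq_lintegral_ofReal (hG.integrable_gaussK (by positivity))]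
  filter_upwards [hG.pos] with v hv using (gaussK_pos d hv _).le

lemma measurable_snDensity (hG : IsMixing d G) : Measurable (snDensity d G) := by
  have := hG.isProb
  have h : snDensity d G = fun x => ∫ v, gaussK d v (‖x‖ ^ 2) ∂G := funext (snDensity_eq hG.pos)
  rw [h]
  have h2 : Measurable (fun z : Vec d × ℝ => gaussK d z.2 (‖z.1‖ ^ 2)) :=
    measurable_snd.gaussK d (by fun_prop)
  exact (h2.stronglyMeasurable.integral_prod_right (ν := G)).measurable

/-- A function that is positive almost everywhere has positive integral. -/
lemma integral_pos_of_ae_pos {α : Type*} [MeasurableSpace α] {P : Measure α} [NeZero P]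
    {f : α → ℝ} (hf : ∀ᵐ x ∂P, 0 < f x) (hi : Integrable f P) : 0 < ∫ x, f x ∂P := by
  rw [integral_pos_iff_support_of_nonneg_ae (hf.mono fun x hx => hx.le) hi]
  have h : Function.support f =ᵐ[P] Set.univ := by
    rw [Filter.eventuallyEq_univ]
    exact hf.mono fun x hx => hx.ne'
  rw [measure_congr h]
  exact (NeZero.ne' (P Set.univ)).symm.bot_lt

lemma snDensity_pos (hG : IsMixing d G) (x : Vec d) : 0 < snDensity d G x := by
  have := hG.isProb
  rw [snDensity_eq hG.pos]
  exact integral_pos_of_ae_pos (hG.pos.mono fun v hv => gaussK_pos d hv _)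
    (hG.integrable_gaussK (by positivity))

lemma snDensity_neg (x : Vec d) : snDensity d G (-x) = snDensity d G x := by
  simp [snDensity, stdNormalDensity]

lemma snDensity_sub_comm (x y : Vec d) : snDensity d G (x - y) = snDensity d G (y - x) := by
  rw [← snDensity_neg, neg_sub]

lemma exists_snDensity_le (hG : IsMixing d G) : ∃ C, ∀ x, snDensity d G x ≤ C := by
  have := hG.isProb
  refine ⟨∫ v, (2 * π) ^ (-((d : ℝ) / 2)) * v ^ (-((d : ℝ) / 2)) ∂G, fun x => ?_⟩
  rw [snDensity_eq hG.pos]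
  refine integral_mono_ae (hG.integrable_gaussK (by positivity)) (hG.moment.const_mul _) ?_
  filter_upwards [hG.pos] with v hv using gaussK_le d hv (by positivity)

/-- Integration against a scale mixture of normals is integration against the normal laws followed
by integration over the variance. -/
lemma lintegral_mul_snDensity (hG : IsMixing d G) (μ : Vec d) {F : Vec d → ENNReal}
    (hF : Measurable F) :
    ∫⁻ x, F x * ENNReal.ofReal (snDensity d G (x - μ)) =
      ∫⁻ v, (∫⁻ x, F x * ENNReal.ofReal (gaussK d v (‖x - μ‖ ^ 2))) ∂G := by
  have := hG.isProb
  have hm : Measurable (fun z : Vec d × ℝ => ENNReal.ofReal (gaussK d z.2 (‖z.1 - μ‖ ^ 2))) :=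
    by fun_prop
  rw [← lintegral_lintegral_swap]
  · refine lintegral_congr fun x => ?_
    rw [ofReal_snDensity hG, lintegral_const_mul _ (by fun_prop)]
  · exact ((hF.comp measurable_fst).mul hm).aemeasurable

lemma lintegral_snDensity (hd : 1 ≤ d) (hG : IsMixing d G) :
    ∫⁻ x, ENNReal.ofReal (snDensity d G x) = 1 := by
  have := hG.isProb
  have h := lintegral_mul_snDensity hG 0 (F := fun _ => 1) measurable_const
  simp only [one_mul, sub_zero] at h
  rw [h, lintegral_congr_ae (g := fun _ => 1)]
  · simp
  · filter_upwards [hG.pos] with v hv using lintegral_gaussK hd hv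

lemma integrable_snDensity (hd : 1 ≤ d) (hG : IsMixing d G) : Integrable (snDensity d G) := by
  refine ⟨(measurable_snDensity hG).aestronglyMeasurable, ?_⟩
  rw [hasFiniteIntegral_iff_ofReal (Filter.Eventually.of_forall fun x => (snDensity_pos hG x).le),
    lintegral_snDensity hd hG]
  exact ENNReal.one_lt_top

lemma integral_snDensity (hd : 1 ≤ d) (hG : IsMixing d G) : ∫ x, snDensity d G x = 1 := by
  rw [integral_eq_lintegral_of_nonneg_ae
    (Filter.Eventually.of_forall fun x => (snDensity_pos hG x).le)
    (measurable_snDensity hG).aestronglyMeasurable, lintegral_snDensity hd hG, ENNReal.toReal_one]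

lemma integrable_snDensity_mul (hd : 1 ≤ d) (hA : IsMixing d A) (hB : IsMixing d B) (a b : Vec d) :
    Integrable (fun x => snDensity d A (x - a) * snDensity d B (x - b)) := by
  obtain ⟨C, hC⟩ := exists_snDensity_le hA
  refine ((integrable_snDensity hd hB).comp_sub_right b).bdd_mul (c := C)
    ((measurable_snDensity hA).comp (measurable_sub_const a)).aestronglyMeasurable
    (Filter.Eventually.of_forall fun x => ?_)
  rw [Real.norm_of_nonneg (snDensity_pos hA _).le]
  exact hC _

lemma IsMixing.conv (hA : IsMixing d A) (hB : IsMixing d B) : IsMixing d (A.conv B) := by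
  have := hA.isProb
  have := hB.isProb
  have hpos : ∀ᵐ z ∂(A.prod B), 0 < z.1 ∧ 0 < z.2 :=
    (Measure.quasiMeasurePreserving_fst.ae hA.pos).and
      (Measure.quasiMeasurePreserving_snd.ae hB.pos)
  have hm : Measurable (fun z : ℝ × ℝ => z.1 + z.2) := by fun_prop
  refine ⟨inferInstance, ?_, ?_⟩
  · rw [Measure.conv, ae_map_iff hm.aemeasurable measurableSet_Ioi]
    filter_upwards [hpos] with z hz using add_pos hz.1 hz.2
  · rw [Measure.conv, integrable_map_measure (Measurable.aestronglyMeasurable (by fun_prop))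
      hm.aemeasurable]
    refine (hA.moment.comp_fst B).mono' (Measurable.aestronglyMeasurable (by fun_prop)) ?_
    filter_upwards [hpos] with z hz
    have h1 := hz.1
    have h2 := hz.2
    simp only [Function.comp]
    rw [Real.norm_of_nonneg (by positivity)]
    exact rpow_le_rpow_of_nonpos h1 (by linarith) (by
      have : (0 : ℝ) ≤ d := by positivity
      linarith)

lemma lintegral_snDensity_mul_sub (hd : 1 ≤ d) (hA : IsMixing d A) (hB : IsMixing d B)
    (y : Vec d) :
    ∫⁻ x, ENNReal.ofReal (snDensity d A x) * ENNReal.ofReal (snDensity d B (y - x)) =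
      ENNReal.ofReal (snDensity d (A.conv B) y) := by
  have := hA.isProb
  have := hB.isProb
  have hA' : Measurable (fun z : Vec d × ℝ => ENNReal.ofReal (gaussK d z.2 (‖z.1‖ ^ 2))) :=
    by fun_prop
  have hB' : Measurable (fun z : Vec d × ℝ => ENNReal.ofReal (gaussK d z.2 (‖y - z.1‖ ^ 2))) :=
    by fun_prop
  simp_rw [ofReal_snDensity hA, ofReal_snDensity hB, ofReal_snDensity (hA.conv hB)]
  rw [Measure.conv, lintegral_map (by fun_prop) (by fun_prop)]
  have h1 : ∀ x : Vec d, (∫⁻ v, ENNReal.ofReal (gaussK d v (‖x‖ ^ 2)) ∂A) *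
      ∫⁻ v, ENNReal.ofReal (gaussK d v (‖y - x‖ ^ 2)) ∂B =
      ∫⁻ z, ENNReal.ofReal (gaussK d z.1 (‖x‖ ^ 2)) *
        ENNReal.ofReal (gaussK d z.2 (‖y - x‖ ^ 2)) ∂(A.prod B) := fun x =>
    (lintegral_prod_mul (hA'.comp measurable_prodMk_left).aemeasurable
      (hB'.comp measurable_prodMk_left).aemeasurable).symm
  simp_rw [h1]
  rw [lintegral_lintegral_swap]
  · refine lintegral_congr_ae ?_
    filter_upwards [Measure.quasiMeasurePreserving_fst.ae hA.pos,
      Measure.quasiMeasurePreserving_snd.ae hB.pos] with z h1 h2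
    exact lintegral_gaussK_mul_sub hd h1 h2 y
  · exact ((hA'.comp (measurable_fst.prodMk measurable_snd.fst)).mul
      (hB'.comp (measurable_fst.prodMk measurable_snd.snd))).aemeasurable

/-- Convolving scale mixtures of normals convolves the mixing distributions. -/
lemma integral_snDensity_mul_sub (hd : 1 ≤ d) (hA : IsMixing d A) (hB : IsMixing d B)
    (y : Vec d) :
    ∫ x, snDensity d A x * snDensity d B (y - x) = snDensity d (A.conv B) y := by
  have hA' := measurable_snDensity hA
  have hB' := measurable_snDensity hB
  rw [integral_eq_lintegral_of_nonneg_ae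
    (Filter.Eventually.of_forall fun x => mul_nonneg (snDensity_pos hA _).le (snDensity_pos hB _).le)
    (by fun_prop)]
  simp_rw [ENNReal.ofReal_mul (snDensity_pos hA _).le]
  rw [lintegral_snDensity_mul_sub hd hA hB, ENNReal.toReal_ofReal (snDensity_pos (hA.conv hB) _).le]

lemma convDensity_snDensity (hd : 1 ≤ d) (hA : IsMixing d A) (hB : IsMixing d B) :
    convDensity (snDensity d A) (snDensity d B) = snDensity d (A.conv B) := by
  ext y
  rw [← integral_snDensity_mul_sub hd hA hB, convDensity, convolution_def]
  simp

lemma integral_snDensity_sub_mul_sub (hd : 1 ≤ d) (hA : IsMixing d A) (hB : IsMixing d B)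
    (a b : Vec d) :
    ∫ x, snDensity d A (x - a) * snDensity d B (x - b) = snDensity d (A.conv B) (b - a) := by
  rw [← integral_snDensity_mul_sub hd hA hB,
    ← integral_sub_right_eq_self (fun x => snDensity d A x * snDensity d B (b - a - x)) a]
  refine integral_congr_ae (Filter.Eventually.of_forall fun x => ?_)
  simp only
  rw [snDensity_sub_comm x b]
  congr 2; abel

lemma mixF_eq (G H : Measure ℝ) : mixF G H = G.conv H := rfl

lemma mixJ_eq (G H : Measure ℝ) [SFinite G] [SFinite H] : mixJ G H = G.conv (H.conv H) := by
  have h1 : Measurable (fun z : ℝ × ℝ => z.1 + z.2) := by fun_prop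
  have h2 : Measurable (Prod.map id (fun z : ℝ × ℝ => z.1 + z.2) : ℝ × ℝ × ℝ → ℝ × ℝ) := by
    fun_prop
  rw [mixJ, Measure.conv, Measure.conv]
  conv_rhs => rw [← Measure.map_id (μ := G)]
  rw [Measure.map_prod_map _ _ measurable_id h1, Measure.map_map h1 h2]
  congr 1
  ext z
  simp [add_assoc]

lemma isMixing_mixJ {H : Measure ℝ} (hG : IsMixing d G) (hH : IsMixing d H) :
    IsMixing d (mixJ G H) := by
  have := hG.isProb
  have := hH.isProb
  rw [mixJ_eq]; exact hG.conv (hH.conv hH)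

/-! ### Location laws -/

lemma isProbabilityMeasure_locLaw (hd : 1 ≤ d) (hG : IsMixing d G) (μ : Vec d) :
    IsProbabilityMeasure (locLaw (snDensity d G) μ) := by
  constructor
  rw [locLaw, withDensity_apply _ MeasurableSet.univ, setLIntegral_univ,
    lintegral_sub_right_eq_self (fun x => ENNReal.ofReal (snDensity d G x)),
    lintegral_snDensity hd hG]

lemma lintegral_locLaw (hG : IsMixing d G) (μ : Vec d) {F : Vec d → ENNReal} (hF : Measurable F) :
    ∫⁻ x, F x ∂(locLaw (snDensity d G) μ) =
      ∫⁻ x, F x * ENNReal.ofReal (snDensity d G (x - μ)) := by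
  have hm := measurable_snDensity hG
  rw [locLaw, lintegral_withDensity_eq_lintegral_mul _ (by fun_prop) hF]
  simp [mul_comm]

lemma integral_locLaw (hG : IsMixing d G) (μ : Vec d) (F : Vec d → ℝ) :
    ∫ x, F x ∂(locLaw (snDensity d G) μ) = ∫ x, F x * snDensity d G (x - μ) := by
  have hm := measurable_snDensity hG
  rw [locLaw, integral_withDensity_eq_integral_toReal_smul (by fun_prop)
    (Filter.Eventually.of_forall fun x => ENNReal.ofReal_lt_top)]
  refine integral_congr_ae (Filter.Eventually.of_forall fun x => ?_)
  simp [ENNReal.toReal_ofReal (snDensity_pos hG (x - μ)).le, mul_comm]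

lemma ae_locLaw_iff (hG : IsMixing d G) (μ : Vec d) {P : Vec d → Prop} :
    (∀ᵐ x ∂(locLaw (snDensity d G) μ), P x) ↔ ∀ᵐ x, P x := by
  have hm := measurable_snDensity hG
  rw [locLaw, ae_withDensity_iff (by fun_prop)]
  refine ⟨fun h => h.mono fun x hx => hx ?_, fun h => h.mono fun x hx _ => hx⟩
  simpa using snDensity_pos hG (x - μ)

end Mixture

/-! ### The integrated squared error risk of plug-in estimators -/

section Risk

variable {d : ℕ} {G H A B : Measure ℝ}

/-- The expected value of `(q * q * p)(muhat(X) - μ)`, where `q * q * p ∼ SN(J)`. Up to a constant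
and the factor `-2` it is the risk of the plug-in estimator `q * p (y - muhat(X))`. -/
def overlap (d : ℕ) (G H : Measure ℝ) (muhat : Vec d → Vec d) (μ : Vec d) : ℝ :=
  ∫ x, snDensity d (mixJ G H) (muhat x - μ) ∂(locLaw (snDensity d G) μ)

lemma l2Loss_snDensity (hd : 1 ≤ d) (hA : IsMixing d A) (hB : IsMixing d B) (μ m : Vec d) :
    l2Loss (snDensity d A) μ (fun y => snDensity d B (y - m)) =
      ENNReal.ofReal (snDensity d (A.conv A) 0 + snDensity d (B.conv B) 0 -
        2 * snDensity d (A.conv B) (m - μ)) ∧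
    0 ≤ snDensity d (A.conv A) 0 + snDensity d (B.conv B) 0 -
        2 * snDensity d (A.conv B) (m - μ) := by
  have iAA := integrable_snDensity_mul hd hA hA μ μ
  have iBB := integrable_snDensity_mul hd hB hB m m
  have iAB := integrable_snDensity_mul hd hA hB μ m
  have iSum : Integrable (fun y => snDensity d A (y - μ) * snDensity d A (y - μ) +
      snDensity d B (y - m) * snDensity d B (y - m)) := iAA.add iBB
  have hsq : ∀ y, |snDensity d A (y - μ) - snDensity d B (y - m)| ^ 2 =
      snDensity d A (y - μ) * snDensity d A (y - μ) + snDensity d B (y - m) * snDensity d B (y - m)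
        - 2 * (snDensity d A (y - μ) * snDensity d B (y - m)) := by
    intro y; rw [sq_abs]; ring
  have hint : ∫ y, |snDensity d A (y - μ) - snDensity d B (y - m)| ^ 2 =
      snDensity d (A.conv A) 0 + snDensity d (B.conv B) 0 -
        2 * snDensity d (A.conv B) (m - μ) := by
    simp_rw [hsq]
    rw [integral_sub iSum (iAB.const_mul 2), integral_add iAA iBB, integral_const_mul,
      integral_snDensity_sub_mul_sub hd hA hA, integral_snDensity_sub_mul_sub hd hB hB,
      integral_snDensity_sub_mul_sub hd hA hB, sub_self, sub_self]
  rw [← hint]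
  refine ⟨?_, integral_nonneg fun y => by positivity⟩
  rw [l2Loss, ofReal_integral_eq_lintegral_ofReal]
  · simp_rw [hsq]
    exact iSum.sub (iAB.const_mul 2)
  · exact Filter.Eventually.of_forall fun y => by positivity

lemma integrable_snDensity_comp_locLaw (hd : 1 ≤ d) (hG : IsMixing d G) (hA : IsMixing d A)
    {muhat : Vec d → Vec d} (hm : Measurable muhat) (μ : Vec d) :
    Integrable (fun x => snDensity d A (muhat x - μ)) (locLaw (snDensity d G) μ) := by
  have := isProbabilityMeasure_locLaw hd hG μ
  obtain ⟨C, hC⟩ := exists_snDensity_le hA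
  have hA' := measurable_snDensity hA
  refine Integrable.of_bound (C := C) (Measurable.aestronglyMeasurable (by fun_prop))
    (Filter.Eventually.of_forall fun x => ?_)
  rw [Real.norm_of_nonneg (snDensity_pos hA _).le]
  exact hC _

/-- Expanding the square, the risk of `q * p (y - muhat(X))` is `∫ q² + ∫ (q * p)²` minus twice the
expected value of `(q * q * p)(muhat(X) - μ)`. -/
lemma l2Risk_plugIn (hd : 1 ≤ d) (hG : IsMixing d G) (hH : IsMixing d H)
    {muhat : Vec d → Vec d} (hm : Measurable muhat) (μ : Vec d) :
    l2Risk (snDensity d G) (snDensity d H) (plugIn (snDensity d (mixF G H)) muhat) μ =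
      ENNReal.ofReal (snDensity d (H.conv H) 0 + snDensity d ((mixF G H).conv (mixF G H)) 0 -
        2 * overlap d G H muhat μ) ∧
    0 ≤ snDensity d (H.conv H) 0 + snDensity d ((mixF G H).conv (mixF G H)) 0 -
        2 * overlap d G H muhat μ := by
  have := hG.isProb
  have := hH.isProb
  have hF : IsMixing d (mixF G H) := hG.conv hH
  have hJ : H.conv (mixF G H) = mixJ G H := by
    rw [mixJ_eq, mixF_eq, ← Measure.conv_assoc, Measure.conv_comm H G, Measure.conv_assoc]
  have hloss := fun m => l2Loss_snDensity hd hH hF μ m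
  rw [hJ] at hloss
  have := isProbabilityMeasure_locLaw hd hG μ
  set A := snDensity d (H.conv H) 0 + snDensity d ((mixF G H).conv (mixF G H)) 0
  have i1 := integrable_snDensity_comp_locLaw hd hG (isMixing_mixJ hG hH) hm μ
  have hint : ∫ x, (A - 2 * snDensity d (mixJ G H) (muhat x - μ)) ∂(locLaw (snDensity d G) μ) =
      A - 2 * overlap d G H muhat μ := by
    rw [integral_sub (integrable_const A) (i1.const_mul 2), integral_const_mul, overlap]
    simp
  have i2 : Integrable (fun x => A - 2 * snDensity d (mixJ G H) (muhat x - μ))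
      (locLaw (snDensity d G) μ) := (integrable_const A).sub (i1.const_mul 2)
  rw [← hint]
  refine ⟨?_, integral_nonneg fun x => (hloss _).2⟩
  rw [ofReal_integral_eq_lintegral_ofReal i2
    (Filter.Eventually.of_forall fun x => (hloss _).2), l2Risk]
  exact lintegral_congr fun x => (hloss (muhat x)).1

lemma l2Risk_plugIn_le_iff (hd : 1 ≤ d) (hG : IsMixing d G) (hH : IsMixing d H)
    {m₁ m₂ : Vec d → Vec d} (h₁ : Measurable m₁) (h₂ : Measurable m₂) (μ : Vec d) :
    l2Risk (snDensity d G) (snDensity d H) (plugIn (snDensity d (mixF G H)) m₁) μ ≤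
      l2Risk (snDensity d G) (snDensity d H) (plugIn (snDensity d (mixF G H)) m₂) μ ↔
    overlap d G H m₂ μ ≤ overlap d G H m₁ μ := by
  obtain ⟨e₁, -⟩ := l2Risk_plugIn hd hG hH h₁ μ
  obtain ⟨e₂, n₂⟩ := l2Risk_plugIn hd hG hH h₂ μ
  rw [e₁, e₂, ENNReal.ofReal_le_ofReal_iff n₂]
  constructor <;> intro h <;> linarith

lemma dominates_l2Risk_plugIn_iff (hd : 1 ≤ d) (hG : IsMixing d G) (hH : IsMixing d H)
    {m₁ m₂ : Vec d → Vec d} (h₁ : Measurable m₁) (h₂ : Measurable m₂) :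
    Dominates (l2Risk (snDensity d G) (snDensity d H) (plugIn (snDensity d (mixF G H)) m₁))
      (l2Risk (snDensity d G) (snDensity d H) (plugIn (snDensity d (mixF G H)) m₂)) ↔
    (∀ μ, overlap d G H m₂ μ ≤ overlap d G H m₁ μ) ∧
      ∃ μ, overlap d G H m₂ μ < overlap d G H m₁ μ := by
  simp_rw [Dominates, ← not_le, l2Risk_plugIn_le_iff hd hG hH h₁ h₂,
    l2Risk_plugIn_le_iff hd hG hH h₂ h₁]

/-- For an integrable loss the extended real valued `pointRisk` is the expected loss. -/
lemma pointRisk_of_integrable {p : Vec d → ℝ} {ℓ : ℝ → ℝ} {muhat : Vec d → Vec d} {μ : Vec d}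
    (hi : Integrable (fun x => ℓ (‖muhat x - μ‖ ^ 2)) (locLaw p μ)) :
    pointRisk p ℓ muhat μ = ((∫ x, ℓ (‖muhat x - μ‖ ^ 2) ∂(locLaw p μ) : ℝ) : EReal) := by
  rw [pointRisk, integral_eq_lintegral_pos_part_sub_lintegral_neg_part hi, EReal.coe_sub,
    EReal.coe_ennreal_toReal, EReal.coe_ennreal_toReal]
  · exact hi.neg.lintegral_lt_top.ne
  · exact hi.lintegral_lt_top.ne

lemma pointRisk_reflectedLoss (hd : 1 ≤ d) (hG : IsMixing d G) (hH : IsMixing d H) (K : ℝ)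
    {muhat : Vec d → Vec d} (hm : Measurable muhat) (μ : Vec d) :
    pointRisk (snDensity d G) (reflectedLoss d (mixJ G H) K) muhat μ =
      ((K - overlap d G H muhat μ : ℝ) : EReal) := by
  have hJ := isMixing_mixJ hG hH
  have := isProbabilityMeasure_locLaw hd hG μ
  have h : ∀ x : Vec d, reflectedLoss d (mixJ G H) K (‖muhat x - μ‖ ^ 2) =
      K - snDensity d (mixJ G H) (muhat x - μ) := fun x => by
    rw [snDensity_eq hJ.pos]; rfl
  have i1 := integrable_snDensity_comp_locLaw hd hG hJ hm μ
  rw [pointRisk_of_integrable]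
  · simp_rw [h]
    rw [integral_sub (integrable_const K) i1, overlap]
    simp
  · simp_rw [h]
    exact (integrable_const K).sub i1

lemma dominates_pointRisk_reflectedLoss_iff (hd : 1 ≤ d) (hG : IsMixing d G) (hH : IsMixing d H)
    (K : ℝ) {m₁ m₂ : Vec d → Vec d} (h₁ : Measurable m₁) (h₂ : Measurable m₂) :
    Dominates (pointRisk (snDensity d G) (reflectedLoss d (mixJ G H) K) m₁)
      (pointRisk (snDensity d G) (reflectedLoss d (mixJ G H) K) m₂) ↔
    (∀ μ, overlap d G H m₂ μ ≤ overlap d G H m₁ μ) ∧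
      ∃ μ, overlap d G H m₂ μ < overlap d G H m₁ μ := by
  simp_rw [Dominates, pointRisk_reflectedLoss hd hG hH K h₁, pointRisk_reflectedLoss hd hG hH K h₂,
    EReal.coe_le_coe_iff, EReal.coe_lt_coe_iff, sub_le_sub_iff_left, sub_lt_sub_iff_left]

/-! ### Minimum risk equivariance -/

lemma isPredictiveDensity_plugIn (hd : 1 ≤ d) (hA : IsMixing d A) {muhat : Vec d → Vec d}
    (hm : Measurable muhat) : IsPredictiveDensity (plugIn (snDensity d A) muhat) where
  measurable := by
    have hA' := measurable_snDensity hA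
    unfold plugIn Function.uncurry
    fun_prop
  nonneg x y := (snDensity_pos hA _).le
  integral_eq_one x := by
    simp only [plugIn]
    rw [integral_sub_right_eq_self, integral_snDensity hd hA]

/-- The risk of an equivariant estimator, with the order of integration exchanged. -/
lemma l2Risk_sub (hG : IsMixing d G) {q g : Vec d → ℝ} (hq : Measurable q) (hg : Measurable g)
    (hd : 1 ≤ d) (μ : Vec d) :
    l2Risk (snDensity d G) q (fun x y => g (y - x)) μ =
      ∫⁻ t, ∫⁻ x, ENNReal.ofReal ((q (t + x - μ) - g t) ^ 2) ∂(locLaw (snDensity d G) μ) := by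
  have := isProbabilityMeasure_locLaw hd hG μ
  rw [← lintegral_lintegral_swap (by fun_prop)]
  refine lintegral_congr fun x => ?_
  rw [l2Loss, ← lintegral_add_right_eq_self _ x]
  simp only [sq_abs, add_sub_cancel_right]

/-- The mean minimizes the expected squared distance. -/
lemma lintegral_sq_sub_integral_le {α : Type*} [MeasurableSpace α] {P : Measure α}
    [IsProbabilityMeasure P] {Y : α → ℝ} {C : ℝ} (hY : Measurable Y) (hC : ∀ x, |Y x| ≤ C) (c : ℝ) :
    ∫⁻ x, ENNReal.ofReal ((Y x - ∫ z, Y z ∂P) ^ 2) ∂P ≤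
      ∫⁻ x, ENNReal.ofReal ((Y x - c) ^ 2) ∂P := by
  set m := ∫ z, Y z ∂P
  have hi : Integrable Y P := Integrable.of_bound (C := C) hY.aestronglyMeasurable
    (Filter.Eventually.of_forall hC)
  have hi2 : Integrable (fun x => Y x ^ 2) P := Integrable.of_bound (C := C ^ 2)
    (by fun_prop) (Filter.Eventually.of_forall fun x => by
      rw [Real.norm_of_nonneg (by positivity), ← sq_abs]
      exact pow_le_pow_left₀ (abs_nonneg _) (hC x) 2)
  have hsq : ∀ b : ℝ, Integrable (fun x => (Y x - b) ^ 2) P ∧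
      ∫ x, (Y x - b) ^ 2 ∂P = ∫ x, Y x ^ 2 ∂P - 2 * b * m + b ^ 2 := by
    intro b
    have e : ∀ x, (Y x - b) ^ 2 = Y x ^ 2 - 2 * b * Y x + b ^ 2 := fun x => by ring
    have i1 : Integrable (fun x => Y x ^ 2 - 2 * b * Y x) P := hi2.sub (hi.const_mul (2 * b))
    simp_rw [e]
    refine ⟨i1.add (integrable_const _), ?_⟩
    rw [integral_add i1 (integrable_const _), integral_sub hi2 (hi.const_mul _),
      integral_const_mul]
    simp [m]
  have hn : ∀ b : ℝ, 0 ≤ᵐ[P] fun x => (Y x - b) ^ 2 := fun b =>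
    Filter.Eventually.of_forall fun x => sq_nonneg _
  rw [← ofReal_integral_eq_lintegral_ofReal (hsq m).1 (hn m),
    ← ofReal_integral_eq_lintegral_ofReal (hsq c).1 (hn c), (hsq m).2, (hsq c).2]
  refine ENNReal.ofReal_le_ofReal ?_
  nlinarith [sq_nonneg (m - c)]

/-- Conditionally on `Y - X`, the estimation error of an equivariant estimator is the distance from
a constant to a random value of `q`, whose mean is `q * p`. -/
lemma isMRE_plugIn (hd : 1 ≤ d) (hG : IsMixing d G) (hH : IsMixing d H) :
    IsMRE (snDensity d G) (snDensity d H) (plugIn (snDensity d (mixF G H)) id) := by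
  have hF : IsMixing d (mixF G H) := hG.conv hH
  have := hG.isProb
  have := hH.isProb
  refine ⟨isPredictiveDensity_plugIn hd hF measurable_id, fun a x y => by simp [plugIn], ?_⟩
  intro qt hqt heq μ
  have hq := measurable_snDensity hH
  have hg : Measurable (qt 0) := hqt.measurable.comp measurable_prodMk_left
  have hqt' : qt = fun x y => qt 0 (y - x) := by
    ext x y
    simpa using heq x 0 (y - x)
  have := isProbabilityMeasure_locLaw hd hG μ
  rw [hqt', l2Risk_sub hG hq hg hd]
  refine (l2Risk_sub hG hq (measurable_snDensity hF) hd μ).trans_le (lintegral_mono fun t => ?_)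
  have hmean : ∫ x, snDensity d H (t + x - μ) ∂(locLaw (snDensity d G) μ) =
      snDensity d (mixF G H) t := by
    rw [integral_locLaw hG]
    have e : ∀ x, snDensity d H (t + x - μ) * snDensity d G (x - μ) =
        snDensity d H (x - (μ - t)) * snDensity d G (x - μ) := fun x => by
      congr 2; abel
    simp_rw [e]
    rw [integral_snDensity_sub_mul_sub hd hH hG, Measure.conv_comm, mixF_eq]
    congr 1; abel
  rw [← hmean]
  obtain ⟨C, hC⟩ := exists_snDensity_le hH
  refine lintegral_sq_sub_integral_le (C := C) (by fun_prop) (fun x => ?_) _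
  rw [abs_of_pos (snDensity_pos hH _)]
  exact hC _

end Risk

/-! ### The mixing distribution of `Z` -/

section MixZ

variable {d : ℕ} {G H J : Measure ℝ}

lemma IsMixing.integrable_rpow_neg (hG : IsMixing d G) {e : ℝ} (he0 : 0 ≤ e) (he : e ≤ (d : ℝ) / 2) :
    Integrable (fun v : ℝ => v ^ (-e)) G := by
  have := hG.isProb
  refine ((integrable_const 1).add hG.moment).mono' (Measurable.aestronglyMeasurable (by fun_prop)) ?_
  filter_upwards [hG.pos] with v hv
  rw [Real.norm_of_nonneg (by positivity)]
  simp only [Pi.add_apply]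
  rcases le_total v 1 with h | h
  · have := rpow_le_rpow_of_exponent_ge hv h (neg_le_neg he)
    linarith
  · have := rpow_le_one_of_one_le_of_nonpos h (neg_nonpos.2 he0)
    have : 0 ≤ v ^ (-((d : ℝ) / 2)) := by positivity
    linarith

/-- Since `V₁ + W₁ + W₂` dominates each of its three summands, its negative moment of order
`d / 2 + 1` is at most a product of three moments of order `(d / 2 + 1) / 3 ≤ d / 2`. -/
lemma integrable_rpow_mixJ (hd : 1 ≤ d) (hG : IsMixing d G) (hH : IsMixing d H) :
    Integrable (fun t : ℝ => t ^ (-((d : ℝ) / 2 + 1))) (mixJ G H) := by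
  have := hG.isProb
  have := hH.isProb
  have hd' : (1 : ℝ) ≤ d := by exact_mod_cast hd
  set e : ℝ := ((d : ℝ) / 2 + 1) / 3 with he
  have he0 : 0 ≤ e := by positivity
  have he1 : e ≤ (d : ℝ) / 2 := by rw [he]; linarith
  have iG := hG.integrable_rpow_neg he0 he1
  have iH := hH.integrable_rpow_neg he0 he1
  rw [mixJ, integrable_map_measure (Measurable.aestronglyMeasurable (by fun_prop)) (by fun_prop)]
  refine (iG.mul_prod (iH.mul_prod iH)).mono' (Measurable.aestronglyMeasurable (by fun_prop)) ?_
  filter_upwards [Measure.quasiMeasurePreserving_fst.ae hG.pos,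
    Measure.quasiMeasurePreserving_snd.ae (Measure.quasiMeasurePreserving_fst.ae hH.pos),
    Measure.quasiMeasurePreserving_snd.ae (Measure.quasiMeasurePreserving_snd.ae hH.pos)]
    with z h1 h2 h3
  have hs : 0 < z.1 + z.2.1 + z.2.2 := by positivity
  simp only [Function.comp]
  rw [Real.norm_of_nonneg (by positivity), show -((d : ℝ) / 2 + 1) = -e + (-e + -e) by rw [he]; ring,
    rpow_add hs, rpow_add hs]
  have hne : -e ≤ 0 := by linarith
  have l1 := rpow_le_rpow_of_nonpos h1 (show z.1 ≤ z.1 + z.2.1 + z.2.2 by linarith) hne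
  have l2 := rpow_le_rpow_of_nonpos h2 (show z.2.1 ≤ z.1 + z.2.1 + z.2.2 by linarith) hne
  have l3 := rpow_le_rpow_of_nonpos h3 (show z.2.2 ≤ z.1 + z.2.1 + z.2.2 by linarith) hne
  gcongr

/-- The real-valued weight whose image in `ENNReal` is `tauWeight`. -/
def realTauWeight (d : ℕ) (z : ℝ × ℝ) : ℝ := 1 / (z.2 * (z.1 + z.2) ^ ((d : ℝ) / 2))

lemma realTauWeight_pos {z : ℝ × ℝ} (h1 : 0 < z.1) (h2 : 0 < z.2) : 0 < realTauWeight d z := by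
  unfold realTauWeight; positivity

lemma measurable_realTauWeight : Measurable (realTauWeight d) := by
  unfold realTauWeight; fun_prop

lemma measurable_tauWeight : Measurable (tauWeight d) := measurable_realTauWeight.ennreal_ofReal

lemma ae_prod_pos (hG : IsMixing d G) (hJ : IsMixing d J) :
    ∀ᵐ z ∂(G.prod J), 0 < z.1 ∧ 0 < z.2 := by
  have := hG.isProb
  have := hJ.isProb
  exact (Measure.quasiMeasurePreserving_fst.ae hG.pos).and
    (Measure.quasiMeasurePreserving_snd.ae hJ.pos)

lemma realTauWeight_le {z : ℝ × ℝ} (h1 : 0 < z.1) (h2 : 0 < z.2) :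
    realTauWeight d z ≤ z.2 ^ (-((d : ℝ) / 2 + 1)) := by
  have h : z.2 ^ ((d : ℝ) / 2) ≤ (z.1 + z.2) ^ ((d : ℝ) / 2) :=
    rpow_le_rpow h2.le (by linarith) (by positivity)
  rw [realTauWeight, rpow_neg h2.le, rpow_add_one h2.ne', ← one_div, mul_comm z.2]
  gcongr

lemma integrable_realTauWeight (hd : 1 ≤ d) (hG : IsMixing d G) (hH : IsMixing d H) :
    Integrable (realTauWeight d) (G.prod (mixJ G H)) := by
  have hJ := isMixing_mixJ hG hH
  have := hG.isProb
  have := hJ.isProb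
  refine ((integrable_rpow_mixJ hd hG hH).comp_snd G).mono'
    measurable_realTauWeight.aestronglyMeasurable ?_
  filter_upwards [ae_prod_pos hG hJ] with z hz
  rw [Real.norm_of_nonneg (realTauWeight_pos hz.1 hz.2).le]
  exact realTauWeight_le hz.1 hz.2

/-- The normalizing constant of `τ`. -/
def tauMass (d : ℕ) (G H : Measure ℝ) : ℝ := ∫ z, realTauWeight d z ∂(G.prod (mixJ G H))

lemma tauMass_pos (hd : 1 ≤ d) (hG : IsMixing d G) (hH : IsMixing d H) : 0 < tauMass d G H := by
  have hJ := isMixing_mixJ hG hH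
  have := hG.isProb
  have := hJ.isProb
  exact integral_pos_of_ae_pos ((ae_prod_pos hG hJ).mono fun z hz => realTauWeight_pos hz.1 hz.2)
    (integrable_realTauWeight hd hG hH)

lemma lintegral_tauWeight (hd : 1 ≤ d) (hG : IsMixing d G) (hH : IsMixing d H) :
    ∫⁻ z, tauWeight d z ∂(G.prod (mixJ G H)) = ENNReal.ofReal (tauMass d G H) := by
  rw [tauMass, ofReal_integral_eq_lintegral_ofReal (integrable_realTauWeight hd hG hH)]
  · rfl
  · exact (ae_prod_pos hG (isMixing_mixJ hG hH)).mono fun z hz => (realTauWeight_pos hz.1 hz.2).le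

lemma isProbabilityMeasure_tau (hd : 1 ≤ d) (hG : IsMixing d G) (hH : IsMixing d H) :
    IsProbabilityMeasure (tau d G H) := by
  constructor
  rw [tau, Measure.smul_apply, withDensity_apply _ MeasurableSet.univ, setLIntegral_univ,
    lintegral_tauWeight hd hG hH, smul_eq_mul]
  exact ENNReal.inv_mul_cancel (by simpa using tauMass_pos hd hG hH) ENNReal.ofReal_ne_top

lemma measurable_harmonic : Measurable (fun z : ℝ × ℝ => z.1 * z.2 / (z.1 + z.2)) := by fun_prop

lemma ae_mixZ_pos (hG : IsMixing d G) (hH : IsMixing d H) : ∀ᵐ v ∂(mixZ d G H), 0 < v := by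
  rw [mixZ, ae_map_iff measurable_harmonic.aemeasurable measurableSet_Ioi, tau]
  refine Measure.ae_smul_measure ((withDensity_absolutelyContinuous _ _).ae_le ?_) _
  filter_upwards [ae_prod_pos hG (isMixing_mixJ hG hH)] with z hz
  exact div_pos (mul_pos hz.1 hz.2) (add_pos hz.1 hz.2)

lemma integrable_mixZ_of_le (hd : 1 ≤ d) (hG : IsMixing d G) (hH : IsMixing d H) {F : ℝ → ℝ}
    (hF : Measurable F) {g : ℝ × ℝ → ℝ} (hg : Integrable g (G.prod (mixJ G H)))
    (hle : ∀ z : ℝ × ℝ, 0 < z.1 → 0 < z.2 →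
      |F (z.1 * z.2 / (z.1 + z.2))| * realTauWeight d z ≤ g z) :
    Integrable F (mixZ d G H) := by
  rw [mixZ, integrable_map_measure hF.aestronglyMeasurable measurable_harmonic.aemeasurable, tau]
  refine Integrable.smul_measure ?_ (by
    rw [lintegral_tauWeight hd hG hH]
    simpa using tauMass_pos hd hG hH)
  rw [integrable_withDensity_iff measurable_tauWeight
    (Filter.Eventually.of_forall fun z => ENNReal.ofReal_lt_top)]
  have hw := measurable_tauWeight (d := d)
  refine hg.mono' (Measurable.aestronglyMeasurable (by fun_prop)) ?_
  filter_upwards [ae_prod_pos hG (isMixing_mixJ hG hH)] with z hz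
  refine le_trans (le_of_eq ?_) (hle z hz.1 hz.2)
  rw [norm_mul, Function.comp, Real.norm_eq_abs, Real.norm_of_nonneg ENNReal.toReal_nonneg]
  congr 1
  exact ENNReal.toReal_ofReal (realTauWeight_pos hz.1 hz.2).le

lemma integral_mixZ (hd : 1 ≤ d) (hG : IsMixing d G) (hH : IsMixing d H) {F : ℝ → ℝ}
    (hF : Measurable F) :
    tauMass d G H * ∫ v, F v ∂(mixZ d G H) =
      ∫ z, F (z.1 * z.2 / (z.1 + z.2)) * realTauWeight d z ∂(G.prod (mixJ G H)) := by
  have hT := tauMass_pos hd hG hH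
  rw [mixZ, integral_map measurable_harmonic.aemeasurable hF.aestronglyMeasurable, tau,
    integral_smul_measure, lintegral_tauWeight hd hG hH,
    integral_withDensity_eq_integral_toReal_smul measurable_tauWeight
      (Filter.Eventually.of_forall fun z => ENNReal.ofReal_lt_top),
    ENNReal.toReal_inv, ENNReal.toReal_ofReal hT.le, smul_eq_mul, mul_inv_cancel_left₀ hT.ne']
  refine integral_congr_ae ?_
  filter_upwards [ae_prod_pos hG (isMixing_mixJ hG hH)] with z hz
  rw [smul_eq_mul, mul_comm]
  congr 1
  exact ENNReal.toReal_ofReal (realTauWeight_pos hz.1 hz.2).le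

lemma isMixing_mixZ (hd : 1 ≤ d) (hG : IsMixing d G) (hH : IsMixing d H) :
    IsMixing d (mixZ d G H) := by
  have hJ := isMixing_mixJ hG hH
  have := isProbabilityMeasure_tau hd hG hH
  refine ⟨Measure.isProbabilityMeasure_map measurable_harmonic.aemeasurable, ae_mixZ_pos hG hH, ?_⟩
  have := hG.isProb
  have := hJ.isProb
  refine integrable_mixZ_of_le hd hG hH (by fun_prop)
    (hG.moment.mul_prod (integrable_rpow_mixJ hd hG hH)) fun z h1 h2 => le_of_eq ?_
  have hs : 0 < z.1 + z.2 := by positivity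
  rw [abs_of_nonneg (by positivity), realTauWeight, div_rpow (by positivity) hs.le,
    mul_rpow h1.le h2.le, rpow_neg hs.le, rpow_neg h2.le (_ + 1), rpow_add_one h2.ne',
    rpow_neg h2.le]
  field_simp

/-- The law `F_Z` always has a finite mean. -/
lemma integrable_id_mixZ (hd : 1 ≤ d) (hG : IsMixing d G) (hH : IsMixing d H) :
    Integrable (fun v : ℝ => v) (mixZ d G H) := by
  have hJ := isMixing_mixJ hG hH
  have := hG.isProb
  have := hJ.isProb
  refine integrable_mixZ_of_le hd hG hH measurable_id (hG.moment.comp_fst (mixJ G H))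
    fun z h1 h2 => ?_
  have hs : 0 < z.1 + z.2 := by positivity
  have h : z.1 ^ ((d : ℝ) / 2) ≤ (z.1 + z.2) ^ ((d : ℝ) / 2) :=
    rpow_le_rpow h1.le (by linarith) (by positivity)
  rw [abs_of_nonneg (by positivity), realTauWeight, rpow_neg h1.le, ← one_div]
  calc z.1 * z.2 / (z.1 + z.2) * (1 / (z.2 * (z.1 + z.2) ^ ((d : ℝ) / 2)))
      = z.1 / (z.1 + z.2) * (1 / (z.1 + z.2) ^ ((d : ℝ) / 2)) := by field_simp
    _ ≤ 1 * (1 / z.1 ^ ((d : ℝ) / 2)) := by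
        gcongr
        rw [div_le_one hs]; linarith
    _ = _ := one_mul _

/-! ### Comparison of the two point estimation problems -/

/-- Minus the derivative of `s ↦ ∫ (2πt)^{-d/2} exp(-s/(2t)) dJ(t)`. -/
def lossSlope (d : ℕ) (J : Measure ℝ) (s : ℝ) : ℝ := ∫ t, gaussK d t s / (2 * t) ∂J

lemma integrable_lossSlope (hd : 1 ≤ d) (hG : IsMixing d G) (hH : IsMixing d H) {s : ℝ}
    (hs : 0 ≤ s) : Integrable (fun t => gaussK d t s / (2 * t)) (mixJ G H) := by
  have hJ := isMixing_mixJ hG hH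
  refine ((integrable_rpow_mixJ hd hG hH).const_mul ((2 * π) ^ (-((d : ℝ) / 2)) / 2)).mono'
    (Measurable.aestronglyMeasurable (by fun_prop)) ?_
  filter_upwards [hJ.pos] with t ht
  have h := gaussK_le d ht hs
  have h0 := gaussK_pos d ht s
  rw [Real.norm_of_nonneg (by positivity)]
  calc gaussK d t s / (2 * t)
      ≤ (2 * π) ^ (-((d : ℝ) / 2)) * t ^ (-((d : ℝ) / 2)) / (2 * t) := by gcongr
    _ = _ := by
      rw [neg_add, ← sub_eq_add_neg, rpow_sub_one ht.ne']
      field_simp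

/-- The product of two normal densities with variances `z₁` and `z₂` is a multiple of the normal
density with variance `z₁ z₂ / (z₁ + z₂)`. Hence the density of `X`, weighted by the slope of the
reflected loss, is proportional to the `SN(F_Z)` density. -/
lemma snDensity_mul_lossSlope (hd : 1 ≤ d) (hG : IsMixing d G) (hH : IsMixing d H) (x : Vec d) :
    snDensity d G x * lossSlope d (mixJ G H) (‖x‖ ^ 2) =
      (2 * π) ^ (-((d : ℝ) / 2)) / 2 * tauMass d G H * snDensity d (mixZ d G H) x := by
  have hJ := isMixing_mixJ hG hH
  have := hG.isProb
  have := hJ.isProb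
  rw [snDensity_eq hG.pos, snDensity_eq (ae_mixZ_pos hG hH), mul_assoc,
    integral_mixZ hd hG hH (by fun_prop), lossSlope, ← integral_prod_mul, ← integral_const_mul]
  refine integral_congr_ae ?_
  filter_upwards [ae_prod_pos hG hJ] with z hz
  obtain ⟨h1, h2⟩ := hz
  have hs : 0 < z.1 + z.2 := by positivity
  rw [← mul_div_assoc, gaussK_mul d h1 h2, mul_rpow (by positivity) hs.le, rpow_neg hs.le,
    realTauWeight]
  field_simp

/-- The kernel is a convex function of the squared norm: it lies above its tangents. -/
lemma gaussK_sub_tangent (d : ℕ) {t : ℝ} (ht : 0 < t) (s s₀ : ℝ) :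
    0 ≤ gaussK d t s - gaussK d t s₀ - gaussK d t s₀ / (2 * t) * (s₀ - s) ∧
    (s ≠ s₀ → 0 < gaussK d t s - gaussK d t s₀ - gaussK d t s₀ / (2 * t) * (s₀ - s)) := by
  have h0 := gaussK_pos d ht s₀
  have e1 : gaussK d t s = gaussK d t s₀ * exp ((s₀ - s) / (2 * t)) := by
    rw [gaussK, gaussK, mul_assoc _ (exp _) (exp _), ← exp_add]; congr 2; ring
  have e2 : gaussK d t s - gaussK d t s₀ - gaussK d t s₀ / (2 * t) * (s₀ - s) =
      gaussK d t s₀ * (exp ((s₀ - s) / (2 * t)) - ((s₀ - s) / (2 * t) + 1)) := by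
    rw [e1]; ring
  rw [e2]
  refine ⟨mul_nonneg h0.le (sub_nonneg.2 (add_one_le_exp _)), fun h => ?_⟩
  refine mul_pos h0 (sub_pos.2 (add_one_lt_exp ?_))
  exact div_ne_zero (sub_ne_zero.2 h.symm) (by positivity)

/-- The expected kernel `s ↦ ∫ (2πt)^{-d/2} exp(-s/(2t)) dJ(t)` is strictly convex. -/
lemma integral_gaussK_sub_tangent (hd : 1 ≤ d) (hG : IsMixing d G) (hH : IsMixing d H) {s s₀ : ℝ}
    (hs : 0 ≤ s) (hs₀ : 0 ≤ s₀) :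
    0 ≤ (∫ t, gaussK d t s ∂(mixJ G H)) - (∫ t, gaussK d t s₀ ∂(mixJ G H)) -
      lossSlope d (mixJ G H) s₀ * (s₀ - s) ∧
    (s ≠ s₀ → 0 < (∫ t, gaussK d t s ∂(mixJ G H)) - (∫ t, gaussK d t s₀ ∂(mixJ G H)) -
      lossSlope d (mixJ G H) s₀ * (s₀ - s)) := by
  have hJ := isMixing_mixJ hG hH
  have := hJ.isProb
  have i1 := hJ.integrable_gaussK hs
  have i2 := hJ.integrable_gaussK hs₀
  have i3 := (integrable_lossSlope hd hG hH hs₀).mul_const (s₀ - s)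
  have i4 : Integrable (fun t => gaussK d t s - gaussK d t s₀) (mixJ G H) := i1.sub i2
  rw [lossSlope, ← integral_mul_const, ← integral_sub i1 i2, ← integral_sub i4 i3]
  exact ⟨integral_nonneg_of_ae (hJ.pos.mono fun t ht => (gaussK_sub_tangent d ht s s₀).1),
    fun h => integral_pos_of_ae_pos (hJ.pos.mono fun t ht => (gaussK_sub_tangent d ht s s₀).2 h)
      (i4.sub i3)⟩

end MixZ

section SquaredError

variable {d : ℕ} {G H A : Measure ℝ}

lemma integrable_locLaw_iff (hA : IsMixing d A) (μ : Vec d) {F : Vec d → ℝ} :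
    Integrable F (locLaw (snDensity d A) μ) ↔
      Integrable (fun x => F x * snDensity d A (x - μ)) := by
  have hm := measurable_snDensity hA
  rw [locLaw, integrable_withDensity_iff_integrable_smul' (by fun_prop)
    (Filter.Eventually.of_forall fun x => ENNReal.ofReal_lt_top)]
  refine integrable_congr (Filter.Eventually.of_forall fun x => ?_)
  simp [ENNReal.toReal_ofReal (snDensity_pos hA (x - μ)).le, mul_comm]

/-- Rescaling to unit variance. -/
lemma integral_mul_gaussK {v : ℝ} (hv : 0 < v) (μ : Vec d) (F : Vec d → ℝ) :
    ∫ x, F x * gaussK d v (‖x - μ‖ ^ 2) =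
      ∫ y, F (√v • y) * gaussK d 1 (‖y - (√v)⁻¹ • μ‖ ^ 2) := by
  have hr : 0 < √v := sqrt_pos.2 hv
  have h := Measure.integral_comp_smul (volume : Measure (Vec d))
    (fun x => F x * gaussK d v (‖x - μ‖ ^ 2)) (√v)
  rw [finrank_euclideanSpace, Fintype.card_fin, smul_eq_mul, abs_of_pos (by positivity)] at h
  rw [eq_comm, inv_mul_eq_iff_eq_mul₀ (by positivity)] at h
  rw [h, ← integral_const_mul]
  refine integral_congr_ae (Filter.Eventually.of_forall fun y => ?_)
  simp only
  have e1 : ‖√v • y - μ‖ ^ 2 = v * ‖y - (√v)⁻¹ • μ‖ ^ 2 := by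
    rw [show √v • y - μ = √v • (y - (√v)⁻¹ • μ) by rw [smul_sub, smul_inv_smul₀ hr.ne'],
      norm_smul, mul_pow, Real.norm_of_nonneg hr.le, sq_sqrt hv.le]
  have e2 : √v ^ d = v ^ ((d : ℝ) / 2) := by
    rw [sqrt_eq_rpow, ← rpow_natCast, ← rpow_mul hv.le]; congr 1; ring
  have e3 : √v ^ d * gaussK d v (v * ‖y - (√v)⁻¹ • μ‖ ^ 2) =
      gaussK d 1 (‖y - (√v)⁻¹ • μ‖ ^ 2) := by
    rw [e2, gaussK_eq_mul d hv, gaussK_eq_mul d one_pos, rpow_neg hv.le, one_rpow, mul_one,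
      mul_comm 2 v, mul_div_mul_left _ _ hv.ne']
    field_simp
  rw [e1, ← e3]
  ring

/-- The second moment of the standard normal law. -/
def secondMoment (d : ℕ) : ℝ := ∫ y : Vec d, ‖y‖ ^ 2 * gaussK d 1 (‖y‖ ^ 2)

lemma integrable_norm_sq_mul_gaussK (hd : 1 ≤ d) {v : ℝ} (hv : 0 < v) (μ : Vec d) :
    Integrable (fun x : Vec d => ‖x - μ‖ ^ 2 * gaussK d v (‖x - μ‖ ^ 2)) := by
  have h := integrable_norm_rpow_mul_gaussK hd (k := 2) (by positivity) hv
  simp_rw [rpow_two] at h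
  exact h.comp_sub_right μ

lemma integral_norm_sq_mul_gaussK {v : ℝ} (hv : 0 < v) (μ : Vec d) :
    ∫ x : Vec d, ‖x - μ‖ ^ 2 * gaussK d v (‖x - μ‖ ^ 2) = v * secondMoment d := by
  rw [integral_sub_right_eq_self (fun x : Vec d => ‖x‖ ^ 2 * gaussK d v (‖x‖ ^ 2)), secondMoment]
  have h := integral_mul_gaussK hv (0 : Vec d) (fun x => ‖x‖ ^ 2)
  simp only [sub_zero, smul_zero] at h
  rw [h, ← integral_const_mul]
  refine integral_congr_ae (Filter.Eventually.of_forall fun y => ?_)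
  simp only
  rw [norm_smul, mul_pow, Real.norm_of_nonneg (sqrt_nonneg v), sq_sqrt hv.le]
  ring

lemma lintegral_norm_sq_locLaw (hd : 1 ≤ d) (hA : IsMixing d A) (μ : Vec d) :
    ∫⁻ x, ENNReal.ofReal (‖x - μ‖ ^ 2) ∂(locLaw (snDensity d A) μ) =
      ∫⁻ v, ENNReal.ofReal (v * secondMoment d) ∂A := by
  rw [lintegral_locLaw hA μ (by fun_prop), lintegral_mul_snDensity hA μ (by fun_prop)]
  refine lintegral_congr_ae ?_
  filter_upwards [hA.pos] with v hv
  rw [← integral_norm_sq_mul_gaussK hv μ, ofReal_integral_eq_lintegral_ofReal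
    (integrable_norm_sq_mul_gaussK hd hv μ)
    (Filter.Eventually.of_forall fun x => mul_nonneg (by positivity) (gaussK_pos d hv _).le)]
  refine lintegral_congr fun x => ?_
  rw [ENNReal.ofReal_mul (by positivity)]

lemma pointRisk_sq (p : Vec d → ℝ) (muhat : Vec d → Vec d) (μ : Vec d) :
    pointRisk p (fun s => s) muhat μ =
      ((∫⁻ x, ENNReal.ofReal (‖muhat x - μ‖ ^ 2) ∂(locLaw p μ) : ENNReal) : EReal) := by
  have h : ∀ x, ENNReal.ofReal (-(‖muhat x - μ‖ ^ 2)) = 0 := fun x =>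
    ENNReal.ofReal_of_nonpos (neg_nonpos.2 (by positivity))
  simp [pointRisk, h]

lemma lintegral_norm_sq_mixZ_lt_top (hd : 1 ≤ d) (hG : IsMixing d G) (hH : IsMixing d H)
    (μ : Vec d) :
    ∫⁻ x, ENNReal.ofReal (‖x - μ‖ ^ 2) ∂(locLaw (snDensity d (mixZ d G H)) μ) < ⊤ := by
  rw [lintegral_norm_sq_locLaw hd (isMixing_mixZ hd hG hH)]
  exact ((integrable_id_mixZ hd hG hH).mul_const _).lintegral_lt_top

/-- If the squared error risk of `muhat` at `μ` under `SN(F_Z)` is at most that of `X`, then the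
plug-in estimator based on `muhat` is at least as good as the one based on `X`. By strict convexity
of the loss it is strictly better unless `muhat(X)` and `X` are almost surely equally far from `μ`. -/
lemma overlap_le_of_sq_risk_le (hd : 1 ≤ d) (hG : IsMixing d G) (hH : IsMixing d H)
    {muhat : Vec d → Vec d} (hm : Measurable muhat) (μ : Vec d)
    (hle : ∫⁻ x, ENNReal.ofReal (‖muhat x - μ‖ ^ 2) ∂(locLaw (snDensity d (mixZ d G H)) μ) ≤
      ∫⁻ x, ENNReal.ofReal (‖x - μ‖ ^ 2) ∂(locLaw (snDensity d (mixZ d G H)) μ)) :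
    overlap d G H id μ ≤ overlap d G H muhat μ ∧
      (overlap d G H muhat μ = overlap d G H id μ →
        ∀ᵐ x : Vec d, ‖muhat x - μ‖ ^ 2 = ‖x - μ‖ ^ 2) := by
  have hJ := isMixing_mixJ hG hH
  have hZ := isMixing_mixZ hd hG hH
  have hT := tauMass_pos hd hG hH
  set c : ℝ := (2 * π) ^ (-((d : ℝ) / 2)) / 2 * tauMass d G H with hc
  have hc0 : 0 < c := by positivity
  have hfin := lintegral_norm_sq_mixZ_lt_top hd hG hH μ
  have hn : ∀ m : Vec d → Vec d,
      0 ≤ᵐ[locLaw (snDensity d (mixZ d G H)) μ] fun x => ‖m x - μ‖ ^ 2 :=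
    fun m => Filter.Eventually.of_forall fun x => by positivity
  have iZ : ∀ m : Vec d → Vec d, Measurable m →
      ∫⁻ x, ENNReal.ofReal (‖m x - μ‖ ^ 2) ∂(locLaw (snDensity d (mixZ d G H)) μ) < ⊤ →
      Integrable (fun x => ‖m x - μ‖ ^ 2) (locLaw (snDensity d (mixZ d G H)) μ) := by
    intro m hm' hlt
    refine ⟨Measurable.aestronglyMeasurable (by fun_prop), ?_⟩
    rwa [hasFiniteIntegral_iff_ofReal (hn m)]
  have i1 := iZ muhat hm (hle.trans_lt hfin)
  have i2 := iZ id measurable_id hfin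
  simp only [id] at i2
  have hleR : ∫ x, ‖muhat x - μ‖ ^ 2 ∂(locLaw (snDensity d (mixZ d G H)) μ) ≤
      ∫ x, ‖x - μ‖ ^ 2 ∂(locLaw (snDensity d (mixZ d G H)) μ) := by
    have hn2 : 0 ≤ᵐ[locLaw (snDensity d (mixZ d G H)) μ] fun x => ‖x - μ‖ ^ 2 := hn id
    rw [integral_eq_lintegral_of_nonneg_ae (hn muhat) i1.aestronglyMeasurable,
      integral_eq_lintegral_of_nonneg_ae hn2 i2.aestronglyMeasurable]
    exact ENNReal.toReal_mono hfin.ne hle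
  rw [integral_locLaw hZ, integral_locLaw hZ] at hleR
  rw [integrable_locLaw_iff hZ] at i1 i2
  have j1 := (integrable_locLaw_iff hG μ).1 (integrable_snDensity_comp_locLaw hd hG hJ hm μ)
  have j2 := (integrable_locLaw_iff hG μ).1
    (integrable_snDensity_comp_locLaw hd hG hJ measurable_id μ)
  simp only [id] at j2
  -- the integrand of the difference of the two predictive risks, minus its linear lower bound
  set D : Vec d → ℝ := fun x =>
    (snDensity d (mixJ G H) (muhat x - μ) * snDensity d G (x - μ) -
      snDensity d (mixJ G H) (x - μ) * snDensity d G (x - μ)) -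
    c * (‖x - μ‖ ^ 2 * snDensity d (mixZ d G H) (x - μ) -
      ‖muhat x - μ‖ ^ 2 * snDensity d (mixZ d G H) (x - μ)) with hD
  have j3 : Integrable (fun x => snDensity d (mixJ G H) (muhat x - μ) * snDensity d G (x - μ) -
      snDensity d (mixJ G H) (x - μ) * snDensity d G (x - μ)) := j1.sub j2
  have j4 : Integrable (fun x => c * (‖x - μ‖ ^ 2 * snDensity d (mixZ d G H) (x - μ) -
      ‖muhat x - μ‖ ^ 2 * snDensity d (mixZ d G H) (x - μ))) := (i2.sub i1).const_mul c
  have hDi : Integrable D := j3.sub j4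
  have hDe : ∀ x, D x = snDensity d G (x - μ) *
      ((∫ t, gaussK d t (‖muhat x - μ‖ ^ 2) ∂(mixJ G H)) -
        (∫ t, gaussK d t (‖x - μ‖ ^ 2) ∂(mixJ G H)) -
        lossSlope d (mixJ G H) (‖x - μ‖ ^ 2) * (‖x - μ‖ ^ 2 - ‖muhat x - μ‖ ^ 2)) := by
    intro x
    have e := snDensity_mul_lossSlope hd hG hH (x - μ)
    rw [← hc] at e
    simp only [hD]
    rw [snDensity_eq hJ.pos, snDensity_eq hJ.pos]
    linear_combination (‖x - μ‖ ^ 2 - ‖muhat x - μ‖ ^ 2) * e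
  have htan := fun x : Vec d => integral_gaussK_sub_tangent hd hG hH
    (s := ‖muhat x - μ‖ ^ 2) (s₀ := ‖x - μ‖ ^ 2) (by positivity) (by positivity)
  have hD0 : ∀ x, 0 ≤ D x := fun x => by
    rw [hDe]; exact mul_nonneg (snDensity_pos hG _).le (htan x).1
  have hDint : ∫ x, D x = (overlap d G H muhat μ - overlap d G H id μ) -
      c * ((∫ x, ‖x - μ‖ ^ 2 * snDensity d (mixZ d G H) (x - μ)) -
        ∫ x, ‖muhat x - μ‖ ^ 2 * snDensity d (mixZ d G H) (x - μ)) := by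
    rw [overlap, overlap, integral_locLaw hG, integral_locLaw hG, hD, integral_sub j3 j4,
      integral_sub j1 j2, integral_const_mul, integral_sub i2 i1]
    rfl
  have hDnn : 0 ≤ ∫ x, D x := integral_nonneg hD0
  have hlin : 0 ≤ c * ((∫ x, ‖x - μ‖ ^ 2 * snDensity d (mixZ d G H) (x - μ)) -
        ∫ x, ‖muhat x - μ‖ ^ 2 * snDensity d (mixZ d G H) (x - μ)) :=
    mul_nonneg hc0.le (sub_nonneg.2 hleR)
  refine ⟨by linarith, fun heq => ?_⟩
  have hzero : ∫ x, D x = 0 := by linarith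
  rw [integral_eq_zero_iff_of_nonneg hD0 hDi] at hzero
  filter_upwards [hzero] with x hx
  by_contra hne
  have := mul_pos (snDensity_pos hG (x - μ)) ((htan x).2 hne)
  rw [← hDe, hx] at this
  exact lt_irrefl _ this

/-- Domination under squared error in the `SN(F_Z)` model carries over to the predictive problem. -/
lemma dominates_l2Risk_of_dominates_sq (hd : 1 ≤ d) (hG : IsMixing d G) (hH : IsMixing d H)
    {muhat : Vec d → Vec d} (hm : Measurable muhat)
    (hdom : Dominates (pointRisk (snDensity d (mixZ d G H)) (fun s => s) muhat)
      (pointRisk (snDensity d (mixZ d G H)) (fun s => s) id)) :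
    Dominates (l2Risk (snDensity d G) (snDensity d H) (plugIn (snDensity d (mixF G H)) muhat))
      (l2Risk (snDensity d G) (snDensity d H) (plugIn (snDensity d (mixF G H)) id)) := by
  obtain ⟨hle, μ, hlt⟩ := hdom
  simp only [pointRisk_sq, EReal.coe_ennreal_le_coe_ennreal_iff,
    EReal.coe_ennreal_lt_coe_ennreal_iff, id] at hle hlt
  rw [dominates_l2Risk_plugIn_iff hd hG hH hm measurable_id]
  refine ⟨fun μ => (overlap_le_of_sq_risk_le hd hG hH hm μ (hle μ)).1, μ, ?_⟩
  obtain ⟨h1, h2⟩ := overlap_le_of_sq_risk_le hd hG hH hm μ (hle μ)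
  refine lt_of_le_of_ne h1 fun heq => hlt.ne (lintegral_congr_ae ?_)
  rw [Filter.EventuallyEq, ae_locLaw_iff (isMixing_mixZ hd hG hH)]
  filter_upwards [h2 heq.symm] with x hx
  rw [hx]

end SquaredError

/-! ### Moments of shifted normal laws -/

section Baranchik

variable {d : ℕ}

lemma gaussK_anti (d : ℕ) {v s s' : ℝ} (hv : 0 < v) (h : s ≤ s') : gaussK d v s' ≤ gaussK d v s := by
  unfold gaussK; gcongr

/-- A bound by a centred Gaussian, uniform for `κ ≥ 1/2`. -/
lemma gaussK_smul_sub_le {v κ : ℝ} (hv : 0 < v) (hκ : 1 / 2 ≤ κ) (x μ : Vec d) :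
    gaussK d v (‖κ • x - μ‖ ^ 2) ≤
      ((2 * π * v) ^ (-((d : ℝ) / 2)) * exp (‖μ‖ ^ 2 / (2 * v))) *
        exp (-(1 / (16 * v)) * ‖x‖ ^ 2) := by
  have h1 : ‖κ • x‖ ≤ ‖κ • x - μ‖ + ‖μ‖ := by
    simpa using norm_add_le (κ • x - μ) μ
  rw [norm_smul, Real.norm_of_nonneg (by linarith)] at h1
  have h2 : ‖x‖ / 2 ≤ ‖κ • x - μ‖ + ‖μ‖ := by
    nlinarith [norm_nonneg x]
  have h3 : ‖x‖ ^ 2 / 8 - ‖μ‖ ^ 2 ≤ ‖κ • x - μ‖ ^ 2 := by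
    nlinarith [norm_nonneg x, norm_nonneg μ, sq_nonneg (‖κ • x - μ‖ - ‖μ‖)]
  refine (gaussK_anti d hv h3).trans (le_of_eq ?_)
  rw [gaussK, mul_assoc _ (exp _) (exp _), ← exp_add]
  congr 2; field_simp; ring

lemma integrable_exp_neg_norm_sq (hd : 3 ≤ d) {b : ℝ} (hb : 0 < b) (α β : ℝ) :
    Integrable (fun x : Vec d => (α + β * (‖x‖ ^ 2)⁻¹) * exp (-b * ‖x‖ ^ 2)) := by
  have hd' : (3 : ℝ) ≤ d := by exact_mod_cast hd
  have i0 := integrable_norm_rpow_mul_exp (d := d) (by omega) (k := 0) (by linarith) hb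
  have i2 := integrable_norm_rpow_mul_exp (d := d) (by omega) (k := -2) (by linarith) hb
  refine ((i0.const_mul α).add (i2.const_mul β)).congr (Filter.Eventually.of_forall fun x => ?_)
  simp only [Pi.add_apply]
  rw [rpow_zero, rpow_neg (norm_nonneg x), rpow_two]
  ring

/-- Integrability of `F` against a normal density when `F` has at most an inverse square singularity
at the origin. -/
lemma integrable_mul_gaussK_of_le (hd : 3 ≤ d) {v : ℝ} (hv : 0 < v) (μ : Vec d) {F : Vec d → ℝ}
    (hF : Measurable F) {α β : ℝ} (hle : ∀ x, |F x| ≤ α + β * (‖x‖ ^ 2)⁻¹) :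
    Integrable (fun x => F x * gaussK d v (‖x - μ‖ ^ 2)) := by
  refine ((integrable_exp_neg_norm_sq hd (b := 1 / (16 * v)) (by positivity) α β).const_mul
    ((2 * π * v) ^ (-((d : ℝ) / 2)) * exp (‖μ‖ ^ 2 / (2 * v)))).mono'
    (Measurable.aestronglyMeasurable (by fun_prop)) (Filter.Eventually.of_forall fun x => ?_)
  have h1 := gaussK_smul_sub_le (d := d) hv (show (1 : ℝ) / 2 ≤ 1 by norm_num) x μ
  rw [one_smul] at h1
  have h2 := gaussK_pos d hv (‖x - μ‖ ^ 2)
  rw [norm_mul, Real.norm_eq_abs, Real.norm_of_nonneg h2.le, mul_left_comm]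
  exact mul_le_mul (hle x) h1 h2.le ((abs_nonneg _).trans (hle x))

/-! ### Monotonicity in the noncentrality -/

/-- The reflection `σ` in the hyperplane of points equally far from `θ₁` and `θ₂`. If `θ₁` is the
closer of the two to the origin, then so is its side of the hyperplane, in the sense that `σ` moves
the points on this side away from the origin. -/
lemma exists_reflection_swap {θ₁ θ₂ : Vec d} (hne : θ₁ ≠ θ₂) (hθ : ‖θ₁‖ ≤ ‖θ₂‖) :
    ∃ σ : Vec d → Vec d, MeasurePreserving σ volume volume ∧ MeasurableEmbedding σ ∧
      (∀ x, ‖σ x - θ₁‖ ^ 2 = ‖x - θ₂‖ ^ 2) ∧ (∀ x, ‖σ x - θ₂‖ ^ 2 = ‖x - θ₁‖ ^ 2) ∧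
      (∀ x, ‖x - θ₁‖ ^ 2 ≤ ‖x - θ₂‖ ^ 2 → ‖x‖ ^ 2 ≤ ‖σ x‖ ^ 2) ∧
      (∀ x, ‖x - θ₂‖ ^ 2 ≤ ‖x - θ₁‖ ^ 2 → ‖σ x‖ ^ 2 ≤ ‖x‖ ^ 2) := by
  obtain ⟨u, hu⟩ : ∃ u, u = θ₂ - θ₁ := ⟨_, rfl⟩
  have hu1 : ‖u‖ ≠ 0 := by
    rw [hu]; exact norm_ne_zero_iff.2 (sub_ne_zero.2 hne.symm)
  have hu0 : 0 < ‖u‖ ^ 2 := by positivity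
  obtain ⟨m, hm⟩ : ∃ m : ℝ, m = (‖θ₂‖ ^ 2 - ‖θ₁‖ ^ 2) / 2 := ⟨_, rfl⟩
  have hm0 : 0 ≤ m := by
    have := pow_le_pow_left₀ (norm_nonneg _) hθ 2
    rw [hm]; linarith
  obtain ⟨R, hR⟩ : ∃ R, R = (ℝ ∙ u)ᗮ.reflection := ⟨_, rfl⟩
  obtain ⟨σ, hσ⟩ : ∃ σ : Vec d → Vec d, σ = fun x => R x + (2 * m / ‖u‖ ^ 2) • u := ⟨_, rfl⟩
  have hσm : MeasurePreserving σ volume volume := by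
    rw [hσ]
    exact (measurePreserving_add_right volume _).comp R.measurePreserving
  have hσe : MeasurableEmbedding σ := by
    rw [hσ]
    exact (MeasurableEquiv.addRight ((2 * m / ‖u‖ ^ 2) • u)).measurableEmbedding.comp
      R.toHomeomorph.measurableEmbedding
  have hσx : ∀ x, σ x = x - (2 * (inner ℝ u x - m) / ‖u‖ ^ 2) • u := by
    intro x
    simp only [hσ, hR]
    rw [Submodule.reflection_orthogonal_apply, Submodule.reflection_singleton_apply]
    simp only [RCLike.ofReal_real_eq_id, id]
    module
  have hσn : ∀ x, ‖σ x‖ ^ 2 = ‖x‖ ^ 2 - 4 * m * (inner ℝ u x - m) / ‖u‖ ^ 2 := by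
    intro x
    rw [hσx, norm_sub_sq_real, norm_smul, mul_pow, Real.norm_eq_abs, sq_abs, inner_smul_right,
      real_inner_comm]
    field_simp; ring
  have hdiff : ∀ x, ‖x - θ₂‖ ^ 2 = ‖x - θ₁‖ ^ 2 - 2 * (inner ℝ u x - m) := by
    intro x
    rw [norm_sub_sq_real, norm_sub_sq_real, hu, inner_sub_left, hm, real_inner_comm x,
      real_inner_comm x]
    ring
  have hσ1 : ∀ x, ‖σ x - θ₁‖ ^ 2 = ‖x - θ₂‖ ^ 2 := by
    intro x
    have h1 : inner ℝ u θ₁ = m - ‖u‖ ^ 2 / 2 := by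
      rw [hm, hu, norm_sub_sq_real, inner_sub_left, real_inner_self_eq_norm_sq]; ring
    rw [hdiff, norm_sub_sq_real, norm_sub_sq_real, hσn, hσx, inner_sub_left, inner_smul_left, h1]
    simp only [conj_trivial]
    field_simp; ring
  have hσ2 : ∀ x, ‖σ x - θ₂‖ ^ 2 = ‖x - θ₁‖ ^ 2 := by
    intro x
    have hσi : inner ℝ u (σ x) = 2 * m - inner ℝ u x := by
      rw [hσx, inner_sub_right, inner_smul_right, real_inner_self_eq_norm_sq]
      field_simp; ring
    rw [hdiff, hσ1, hσi, hdiff]; ring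
  refine ⟨σ, hσm, hσe, hσ1, hσ2, fun x hx => ?_, fun x hx => ?_⟩
  · rw [hdiff] at hx
    have : 4 * m * (inner ℝ u x - m) / ‖u‖ ^ 2 ≤ 0 :=
      div_nonpos_of_nonpos_of_nonneg
        (mul_nonpos_of_nonneg_of_nonpos (by positivity) (by linarith)) hu0.le
    rw [hσn]; linarith
  · rw [hdiff] at hx
    have : 0 ≤ 4 * m * (inner ℝ u x - m) / ‖u‖ ^ 2 :=
      div_nonneg (mul_nonneg (by positivity) (by linarith)) hu0.le
    rw [hσn]; linarith

/-- The mean of a decreasing function of `‖X‖²`, `X ∼ N(θ, v I)`, decreases with `‖θ‖`. With the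
reflection `σ` that swaps `θ₁` and `θ₂`, twice the difference of the two means is the integral of
`(f(‖x‖²) - f(‖σ x‖²)) (φ(x - θ₁) - φ(x - θ₂))`, where the two factors have the same sign. -/
lemma integral_antitone_mul_gaussK_le (hd : 1 ≤ d) {f : ℝ → ℝ} (hf : AntitoneOn f (Set.Ioi 0))
    {v : ℝ} (hv : 0 < v) {θ₁ θ₂ : Vec d} (hθ : ‖θ₁‖ ≤ ‖θ₂‖)
    (h₁ : Integrable (fun x => f (‖x‖ ^ 2) * gaussK d v (‖x - θ₁‖ ^ 2)))
    (h₂ : Integrable (fun x => f (‖x‖ ^ 2) * gaussK d v (‖x - θ₂‖ ^ 2))) :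
    ∫ x, f (‖x‖ ^ 2) * gaussK d v (‖x - θ₂‖ ^ 2) ≤
      ∫ x, f (‖x‖ ^ 2) * gaussK d v (‖x - θ₁‖ ^ 2) := by
  have : Nonempty (Fin d) := ⟨⟨0, hd⟩⟩
  rcases eq_or_ne θ₁ θ₂ with rfl | hne
  · exact le_rfl
  obtain ⟨σ, hσm, hσe, hσ1, hσ2, hout, hin⟩ := exists_reflection_swap hne hθ
  have e1 := hσm.integral_comp hσe (fun x => f (‖x‖ ^ 2) * gaussK d v (‖x - θ₁‖ ^ 2))
  have e2 := hσm.integral_comp hσe (fun x => f (‖x‖ ^ 2) * gaussK d v (‖x - θ₂‖ ^ 2))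
  have i1 := (hσm.integrable_comp_emb hσe).2 h₁
  have i2 := (hσm.integrable_comp_emb hσe).2 h₂
  simp only [Function.comp_def, hσ1, hσ2] at e1 e2 i1 i2
  have hpos : 0 ≤ ∫ x, ((f (‖x‖ ^ 2) * gaussK d v (‖x - θ₁‖ ^ 2) -
      f (‖x‖ ^ 2) * gaussK d v (‖x - θ₂‖ ^ 2)) -
      (f (‖σ x‖ ^ 2) * gaussK d v (‖x - θ₁‖ ^ 2) -
        f (‖σ x‖ ^ 2) * gaussK d v (‖x - θ₂‖ ^ 2))) := by
    refine integral_nonneg_of_ae ?_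
    have hz : ∀ᵐ x : Vec d, x ≠ 0 := Measure.ae_ne volume 0
    filter_upwards [hz, hσm.quasiMeasurePreserving.ae hz] with x hx hx'
    have q1 : 0 < ‖x‖ ^ 2 := by positivity
    have q2 : 0 < ‖σ x‖ ^ 2 := by positivity
    have key : (f (‖x‖ ^ 2) * gaussK d v (‖x - θ₁‖ ^ 2) -
      f (‖x‖ ^ 2) * gaussK d v (‖x - θ₂‖ ^ 2)) -
      (f (‖σ x‖ ^ 2) * gaussK d v (‖x - θ₁‖ ^ 2) -
        f (‖σ x‖ ^ 2) * gaussK d v (‖x - θ₂‖ ^ 2)) = (f (‖x‖ ^ 2) - f (‖σ x‖ ^ 2)) *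
        (gaussK d v (‖x - θ₁‖ ^ 2) - gaussK d v (‖x - θ₂‖ ^ 2)) := by ring
    simp only [Pi.zero_apply]
    rw [key]
    rcases le_total (‖x - θ₁‖ ^ 2) (‖x - θ₂‖ ^ 2) with h | h
    · exact mul_nonneg (sub_nonneg.2 (hf q1 q2 (hout x h))) (sub_nonneg.2 (gaussK_anti d hv h))
    · exact mul_nonneg_of_nonpos_of_nonpos (sub_nonpos.2 (hf q2 q1 (hin x h)))
        (sub_nonpos.2 (gaussK_anti d hv h))
  have j1 : Integrable (fun x => f (‖x‖ ^ 2) * gaussK d v (‖x - θ₁‖ ^ 2) -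
      f (‖x‖ ^ 2) * gaussK d v (‖x - θ₂‖ ^ 2)) := h₁.sub h₂
  have j2 : Integrable (fun x => f (‖σ x‖ ^ 2) * gaussK d v (‖x - θ₁‖ ^ 2) -
      f (‖σ x‖ ^ 2) * gaussK d v (‖x - θ₂‖ ^ 2)) := i2.sub i1
  rw [integral_sub j1 j2, integral_sub h₁ h₂, integral_sub i2 i1, e1, e2] at hpos
  linarith

/-! ### A Stein inequality for monotone shrinkage factors -/

lemma abs_shrink_le {r : ℝ → ℝ} (h01 : ∀ t, 0 ≤ r t ∧ r t ≤ 1) (x : Vec d) :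
    |r (‖x‖ ^ 2) / ‖x‖ ^ 2| ≤ 0 + 1 * (‖x‖ ^ 2)⁻¹ := by
  rw [abs_of_nonneg (div_nonneg (h01 _).1 (by positivity)), div_eq_mul_inv, zero_add]
  exact mul_le_mul_of_nonneg_right (h01 _).2 (by positivity)

lemma abs_shrink_mul_inner_le {r : ℝ → ℝ} (h01 : ∀ t, 0 ≤ r t ∧ r t ≤ 1) {κ : ℝ} (hκ0 : 0 ≤ κ)
    (hκ : κ ≤ 2) (x μ : Vec d) :
    |r (‖x‖ ^ 2) / ‖x‖ ^ 2 * inner ℝ x (κ • x - μ)| ≤ (2 + ‖μ‖) + ‖μ‖ * (‖x‖ ^ 2)⁻¹ := by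
  rcases eq_or_ne x 0 with rfl | hx
  · simp; positivity
  have hx0 : 0 < ‖x‖ := norm_pos_iff.2 hx
  have h1 : |inner ℝ x (κ • x - μ)| ≤ ‖x‖ * (2 * ‖x‖ + ‖μ‖) := by
    refine (abs_real_inner_le_norm _ _).trans ?_
    gcongr
    refine (norm_sub_le _ _).trans ?_
    rw [norm_smul, Real.norm_of_nonneg hκ0]
    gcongr
  have h2 := abs_shrink_le h01 x
  rw [zero_add, one_mul] at h2
  rw [abs_mul]
  calc |r (‖x‖ ^ 2) / ‖x‖ ^ 2| * |inner ℝ x (κ • x - μ)|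
      ≤ (‖x‖ ^ 2)⁻¹ * (‖x‖ * (2 * ‖x‖ + ‖μ‖)) := by gcongr
    _ = 2 + ‖μ‖ * ‖x‖⁻¹ := by field_simp
    _ ≤ 2 + ‖μ‖ * (1 + (‖x‖ ^ 2)⁻¹) := by
        gcongr
        rw [← inv_pow]
        nlinarith [sq_nonneg (‖x‖⁻¹ - 1), sq_nonneg (‖x‖⁻¹)]
    _ = _ := by ring

/-- Dilating the normal density by `κ⁻¹ ≥ 1` amounts to dilating `r(‖x‖²) / ‖x‖²`, and `r` is
nondecreasing. -/
lemma rpow_mul_integral_shrink_le (hd : 3 ≤ d) {r : ℝ → ℝ} (hr : Monotone r)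
    (h01 : ∀ t, 0 ≤ r t ∧ r t ≤ 1) {v : ℝ} (hv : 0 < v) (μ : Vec d) {κ : ℝ} (hκ : 0 < κ)
    (hκ1 : κ ≤ 1) :
    κ ^ 2 * ∫ x, r (‖x‖ ^ 2) / ‖x‖ ^ 2 * gaussK d v (‖x - μ‖ ^ 2) ≤
      κ ^ d * ∫ x, r (‖x‖ ^ 2) / ‖x‖ ^ 2 * gaussK d v (‖κ • x - μ‖ ^ 2) := by
  have hrm := hr.measurable
  have h := Measure.integral_comp_smul (volume : Measure (Vec d))
    (fun y => r (‖κ⁻¹ • y‖ ^ 2) / ‖κ⁻¹ • y‖ ^ 2 * gaussK d v (‖y - μ‖ ^ 2)) κ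
  simp only [inv_smul_smul₀ hκ.ne'] at h
  rw [finrank_euclideanSpace, Fintype.card_fin, smul_eq_mul, abs_of_pos (by positivity)] at h
  rw [h, mul_inv_cancel_left₀ (by positivity), ← integral_const_mul]
  have hsq : ∀ y : Vec d, ‖κ⁻¹ • y‖ ^ 2 = (κ ^ 2)⁻¹ * ‖y‖ ^ 2 := fun y => by
    rw [norm_smul, mul_pow, Real.norm_of_nonneg (by positivity), inv_pow]
  refine integral_mono ?_ ?_ fun y => ?_
  · exact (integrable_mul_gaussK_of_le hd hv μ (by fun_prop) (abs_shrink_le h01)).const_mul _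
  · refine integrable_mul_gaussK_of_le hd hv μ (α := 0) (β := κ ^ 2) (by fun_prop) fun y => ?_
    have := abs_shrink_le h01 (κ⁻¹ • y)
    rw [hsq] at this ⊢
    refine this.trans (le_of_eq ?_)
    rw [mul_inv, inv_inv]; ring
  · have hle : r (‖y‖ ^ 2) ≤ r ((κ ^ 2)⁻¹ * ‖y‖ ^ 2) := by
      refine hr (le_mul_of_one_le_left (by positivity) ?_)
      exact (one_le_inv₀ (by positivity)).2 (pow_le_one₀ hκ.le hκ1)
    have h0 := gaussK_pos d hv (‖y - μ‖ ^ 2)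
    simp only [hsq]
    calc κ ^ 2 * (r (‖y‖ ^ 2) / ‖y‖ ^ 2 * gaussK d v (‖y - μ‖ ^ 2))
        ≤ κ ^ 2 * (r ((κ ^ 2)⁻¹ * ‖y‖ ^ 2) / ‖y‖ ^ 2 * gaussK d v (‖y - μ‖ ^ 2)) := by gcongr
      _ = _ := by
        rw [div_mul_eq_div_div_swap, div_inv_eq_mul]
        ring

/-- For a nondecreasing `r`, not assumed differentiable, integration by parts is replaced by
differentiating in the scale of the normal density. -/
lemma stein_shrink_le (hd : 3 ≤ d) {r : ℝ → ℝ} (hr : Monotone r) (h01 : ∀ t, 0 ≤ r t ∧ r t ≤ 1)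
    {v : ℝ} (hv : 0 < v) (μ : Vec d) :
    v * (((d : ℝ) - 2) * ∫ x, r (‖x‖ ^ 2) / ‖x‖ ^ 2 * gaussK d v (‖x - μ‖ ^ 2)) ≤
      ∫ x, r (‖x‖ ^ 2) / ‖x‖ ^ 2 * inner ℝ x (x - μ) * gaussK d v (‖x - μ‖ ^ 2) := by
  have hrm := hr.measurable
  set Φ : ℝ → ℝ := fun κ => ∫ x, r (‖x‖ ^ 2) / ‖x‖ ^ 2 * gaussK d v (‖κ • x - μ‖ ^ 2) with hΦ
  set I : ℝ := ∫ x, r (‖x‖ ^ 2) / ‖x‖ ^ 2 * inner ℝ x (x - μ) * gaussK d v (‖x - μ‖ ^ 2) with hI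
  have hΦ1 : Φ 1 = ∫ x, r (‖x‖ ^ 2) / ‖x‖ ^ 2 * gaussK d v (‖x - μ‖ ^ 2) := by
    simp only [hΦ, one_smul]
  have hderiv : HasDerivAt Φ (-(I / v)) 1 := by
    have h := hasDerivAt_integral_of_dominated_loc_of_deriv_le (μ := (volume : Measure (Vec d)))
      (F := fun κ x => r (‖x‖ ^ 2) / ‖x‖ ^ 2 * gaussK d v (‖κ • x - μ‖ ^ 2))
      (F' := fun κ x => -(r (‖x‖ ^ 2) / ‖x‖ ^ 2 * inner ℝ x (κ • x - μ) *
        gaussK d v (‖κ • x - μ‖ ^ 2) / v))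
      (bound := fun x => ((2 * π * v) ^ (-((d : ℝ) / 2)) * exp (‖μ‖ ^ 2 / (2 * v)) / v) *
        (((2 + ‖μ‖) + ‖μ‖ * (‖x‖ ^ 2)⁻¹) * exp (-(1 / (16 * v)) * ‖x‖ ^ 2)))
      (x₀ := (1 : ℝ)) (s := Set.Icc (1 / 2) 2) (Icc_mem_nhds (by norm_num) (by norm_num))
      (Filter.Eventually.of_forall fun κ => Measurable.aestronglyMeasurable (by fun_prop))
      (by
        simpa only [one_smul] using
          integrable_mul_gaussK_of_le hd hv μ (by fun_prop) (abs_shrink_le h01))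
      (Measurable.aestronglyMeasurable (by fun_prop)) ?_
      ((integrable_exp_neg_norm_sq hd (by positivity) _ _).const_mul _) ?_
    · have h2 := h.2
      simp only [one_smul] at h2
      rwa [integral_neg, integral_div, ← hI] at h2
    · refine Filter.Eventually.of_forall fun x κ hκ => ?_
      have b1 := abs_shrink_mul_inner_le h01 (by linarith [hκ.1]) hκ.2 x μ
      have b2 := gaussK_smul_sub_le hv hκ.1 x μ
      have b3 := gaussK_pos d hv (‖κ • x - μ‖ ^ 2)
      rw [norm_neg, norm_div, norm_mul, Real.norm_of_nonneg hv.le, Real.norm_of_nonneg b3.le,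
        Real.norm_eq_abs]
      calc _ ≤ ((2 + ‖μ‖) + ‖μ‖ * (‖x‖ ^ 2)⁻¹) * (((2 * π * v) ^ (-((d : ℝ) / 2)) *
            exp (‖μ‖ ^ 2 / (2 * v))) * exp (-(1 / (16 * v)) * ‖x‖ ^ 2)) / v := by gcongr
        _ = _ := by ring
    · refine Filter.Eventually.of_forall fun x κ _ => ?_
      have e : ∀ κ : ℝ, ‖κ • x - μ‖ ^ 2 = κ ^ 2 * ‖x‖ ^ 2 - 2 * (κ * inner ℝ x μ) + ‖μ‖ ^ 2 := by
        intro κ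
        rw [norm_sub_sq_real, norm_smul, mul_pow, Real.norm_eq_abs, sq_abs, real_inner_smul_left]
      have d1 : HasDerivAt (fun κ : ℝ => -(‖κ • x - μ‖ ^ 2 / (2 * v)))
          (-(inner ℝ x (κ • x - μ) / v)) κ := by
        simp_rw [e]
        have h1 := (((((hasDerivAt_id κ).pow 2).mul_const (‖x‖ ^ 2)).sub
          (((hasDerivAt_id κ).mul_const (inner ℝ x μ)).const_mul 2)).add_const
          (‖μ‖ ^ 2)).div_const (2 * v)
        refine h1.neg.congr_deriv ?_
        rw [inner_sub_right, inner_smul_right, real_inner_self_eq_norm_sq]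
        simp only [id]
        field_simp
        push_cast
        ring
      have d2 := ((d1.exp.const_mul ((2 * π * v) ^ (-((d : ℝ) / 2)))).const_mul
        (r (‖x‖ ^ 2) / ‖x‖ ^ 2))
      refine d2.congr_deriv ?_
      simp only [gaussK]
      ring
  -- `ψ ≥ 0` on `(0, 1]` and `ψ 1 = 0`, so that `ψ' 1 ≤ 0`
  set ψ : ℝ → ℝ := fun κ => κ ^ d * Φ κ - κ ^ 2 * Φ 1 with hψ
  have hψ' : HasDerivAt ψ (d * Φ 1 + -(I / v) - 2 * Φ 1) 1 := by
    have h := ((hasDerivAt_pow d (1 : ℝ)).mul hderiv).sub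
      ((hasDerivAt_pow 2 (1 : ℝ)).mul_const (Φ 1))
    refine h.congr_deriv ?_
    simp
  have hle : d * Φ 1 + -(I / v) - 2 * Φ 1 ≤ 0 := by
    have ht := (hasDerivAt_iff_tendsto_slope.1 hψ').mono_left
      (nhdsWithin_mono 1 (show Set.Iio (1 : ℝ) ⊆ {1}ᶜ from fun x hx => ne_of_lt hx))
    refine le_of_tendsto ht ?_
    filter_upwards [Ioo_mem_nhdsLT (show (0 : ℝ) < 1 by norm_num)] with κ hκ
    have h1 : ψ 1 = 0 := by simp [hψ]
    have h2 : 0 ≤ ψ κ := by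
      have := rpow_mul_integral_shrink_le hd hr h01 hv μ hκ.1 hκ.2.le
      rw [← hΦ1] at this
      exact sub_nonneg.2 this
    rw [slope_def_field, h1, sub_zero]
    exact div_nonpos_of_nonneg_of_nonpos h2 (by linarith [hκ.2])
  rw [← hΦ1]
  have h3 : ((d : ℝ) - 2) * Φ 1 ≤ I / v := by linarith
  rw [le_div_iff₀ hv] at h3
  linarith

/-! ### Baranchik type estimators under squared error -/

/-- For a normal variable with variance `v`, `v` times the mean of `r(‖X‖²) / ‖X‖²` is nondecreasing
in `v`: after rescaling, both the shrinkage factor grows and the noncentrality decreases. -/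
lemma mul_integral_shrink_mono (hd : 3 ≤ d) {r : ℝ → ℝ} (hr : Monotone r)
    (h01 : ∀ t, 0 ≤ r t ∧ r t ≤ 1) (hanti : AntitoneOn (fun t => r t / t) (Set.Ioi 0))
    (μ : Vec d) {v v' : ℝ} (hv : 0 < v) (hvv : v ≤ v') :
    v * ∫ x, r (‖x‖ ^ 2) / ‖x‖ ^ 2 * gaussK d v (‖x - μ‖ ^ 2) ≤
      v' * ∫ x, r (‖x‖ ^ 2) / ‖x‖ ^ 2 * gaussK d v' (‖x - μ‖ ^ 2) := by
  have hrm := hr.measurable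
  have hv' : 0 < v' := hv.trans_le hvv
  have hM : ∀ {t : ℝ}, 0 < t → t * ∫ x, r (‖x‖ ^ 2) / ‖x‖ ^ 2 * gaussK d t (‖x - μ‖ ^ 2) =
      ∫ y, r (t * ‖y‖ ^ 2) / ‖y‖ ^ 2 * gaussK d 1 (‖y - (√t)⁻¹ • μ‖ ^ 2) := by
    intro t ht
    rw [integral_mul_gaussK ht μ (fun x => r (‖x‖ ^ 2) / ‖x‖ ^ 2), ← integral_const_mul]
    refine integral_congr_ae (Filter.Eventually.of_forall fun y => ?_)
    simp only
    rw [norm_smul, mul_pow, Real.norm_of_nonneg (sqrt_nonneg t), sq_sqrt ht.le,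
      div_mul_eq_div_div_swap, ← mul_assoc, mul_div_cancel₀ _ ht.ne']
  have hint : ∀ (t : ℝ) (θ : Vec d),
      Integrable (fun y => r (t * ‖y‖ ^ 2) / ‖y‖ ^ 2 * gaussK d 1 (‖y - θ‖ ^ 2)) := by
    intro t θ
    refine integrable_mul_gaussK_of_le hd one_pos θ (α := 0) (β := 1) (by fun_prop) fun y => ?_
    rw [abs_of_nonneg (div_nonneg (h01 _).1 (by positivity)), div_eq_mul_inv, zero_add]
    exact mul_le_mul_of_nonneg_right (h01 _).2 (by positivity)
  rw [hM hv, hM hv']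
  refine le_trans (integral_mono (hint v _) (hint v' ((√v)⁻¹ • μ)) fun y => ?_) ?_
  · have h0 := gaussK_pos d one_pos (‖y - (√v)⁻¹ • μ‖ ^ 2)
    have h1 : r (v * ‖y‖ ^ 2) ≤ r (v' * ‖y‖ ^ 2) := hr (by gcongr)
    simp only
    gcongr
  · refine integral_antitone_mul_gaussK_le (by omega) (f := fun s => r (v' * s) / s) ?_ one_pos ?_
      (hint v' _) (hint v' _)
    · intro s hs t ht hst
      have hs : 0 < s := hs
      have ht : 0 < t := ht
      have h := hanti (show v' * s ∈ Set.Ioi 0 from mul_pos hv' hs)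
        (show v' * t ∈ Set.Ioi 0 from mul_pos hv' ht) (by gcongr)
      simp only at h ⊢
      rw [div_mul_eq_div_div_swap, div_mul_eq_div_div_swap] at h
      exact (div_le_div_iff_of_pos_right hv').1 h
    · rw [norm_smul, norm_smul, norm_inv, norm_inv, Real.norm_of_nonneg (sqrt_nonneg _),
        Real.norm_of_nonneg (sqrt_nonneg _)]
      have := sqrt_pos.2 hv
      gcongr

lemma norm_baranchik_sub_sq_le {r : ℝ → ℝ} (h01 : ∀ t, 0 ≤ r t ∧ r t ≤ 1) (a : ℝ)
    (x μ : Vec d) :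
    ‖baranchik a r x - μ‖ ^ 2 ≤ ‖x - μ‖ ^ 2 + a ^ 2 * (r (‖x‖ ^ 2) / ‖x‖ ^ 2) -
      2 * a * (r (‖x‖ ^ 2) / ‖x‖ ^ 2 * inner ℝ x (x - μ)) := by
  rw [show baranchik a r x - μ = (x - μ) - (a * (r (‖x‖ ^ 2) / ‖x‖ ^ 2)) • x by
    rw [baranchik, sub_smul, one_smul]; abel]
  rw [norm_sub_sq_real, norm_smul, mul_pow, Real.norm_eq_abs, sq_abs, inner_smul_right,
    real_inner_comm]
  have h1 : (r (‖x‖ ^ 2) / ‖x‖ ^ 2) ^ 2 * ‖x‖ ^ 2 ≤ r (‖x‖ ^ 2) / ‖x‖ ^ 2 := by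
    rcases eq_or_ne (‖x‖ ^ 2) 0 with h | h
    · simp [h]
    · calc (r (‖x‖ ^ 2) / ‖x‖ ^ 2) ^ 2 * ‖x‖ ^ 2
          = r (‖x‖ ^ 2) * (r (‖x‖ ^ 2) / ‖x‖ ^ 2) := by field_simp
        _ ≤ 1 * (r (‖x‖ ^ 2) / ‖x‖ ^ 2) :=
          mul_le_mul_of_nonneg_right (h01 _).2 (div_nonneg (h01 _).1 (by positivity))
        _ = _ := one_mul _
  nlinarith [mul_le_mul_of_nonneg_left h1 (sq_nonneg a)]

lemma measurable_baranchik (a : ℝ) {r : ℝ → ℝ} (hr : Measurable r) :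
    Measurable (baranchik (d := d) a r) := by
  unfold baranchik; fun_prop

/-- The squared error risk of a Baranchik type estimator given the variance `v`. With `M(v)` the
nondecreasing function of `mul_integral_shrink_mono`, the improvement over `v · secondMoment` is at
least `-a M(v) (a / v - 2 (d - 2))`, and `M(v)` may be replaced by its value at the zero
`v₀ = a / (2 (d - 2))` of the decreasing last factor. -/
lemma exists_lintegral_baranchik_le (hd : 3 ≤ d) {r : ℝ → ℝ} (hr : Monotone r)
    (h01 : ∀ t, 0 ≤ r t ∧ r t ≤ 1) (hanti : AntitoneOn (fun t => r t / t) (Set.Ioi 0))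
    {a : ℝ} (ha : 0 < a) (μ : Vec d) :
    ∃ C, 0 ≤ C ∧ ∀ v, 0 < v → 0 ≤ v * secondMoment d + C * (a * v⁻¹ - 2 * ((d : ℝ) - 2)) ∧
      ∫⁻ x, ENNReal.ofReal (‖baranchik a r x - μ‖ ^ 2) *
        ENNReal.ofReal (gaussK d v (‖x - μ‖ ^ 2)) ≤
        ENNReal.ofReal (v * secondMoment d + C * (a * v⁻¹ - 2 * ((d : ℝ) - 2))) := by
  have hd' : (0 : ℝ) < (d : ℝ) - 2 := by
    have : (3 : ℝ) ≤ d := by exact_mod_cast hd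
    linarith
  have hrm := hr.measurable
  set m : ℝ → ℝ := fun v => ∫ x, r (‖x‖ ^ 2) / ‖x‖ ^ 2 * gaussK d v (‖x - μ‖ ^ 2) with hm
  have hmn : ∀ {v}, 0 < v → 0 ≤ m v := fun hv => integral_nonneg fun x =>
    mul_nonneg (div_nonneg (h01 _).1 (by positivity)) (gaussK_pos d hv _).le
  set v₀ : ℝ := a / (2 * ((d : ℝ) - 2)) with hv₀
  have hv₀pos : 0 < v₀ := by positivity
  refine ⟨a * (v₀ * m v₀), by have := hmn hv₀pos; positivity, fun v hv => ?_⟩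
  have i0 := integrable_norm_sq_mul_gaussK (d := d) (by omega) hv μ
  have i1 : Integrable (fun x : Vec d => r (‖x‖ ^ 2) / ‖x‖ ^ 2 * gaussK d v (‖x - μ‖ ^ 2)) :=
    integrable_mul_gaussK_of_le hd hv μ (by fun_prop) (abs_shrink_le h01)
  have i2 : Integrable (fun x : Vec d => r (‖x‖ ^ 2) / ‖x‖ ^ 2 * inner ℝ x (x - μ) *
      gaussK d v (‖x - μ‖ ^ 2)) :=
    integrable_mul_gaussK_of_le hd hv μ (by fun_prop) fun x => by
      simpa only [one_smul] using abs_shrink_mul_inner_le h01 zero_le_one one_le_two x μ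
  set B : Vec d → ℝ := fun x => ‖x - μ‖ ^ 2 * gaussK d v (‖x - μ‖ ^ 2) +
    a ^ 2 * (r (‖x‖ ^ 2) / ‖x‖ ^ 2 * gaussK d v (‖x - μ‖ ^ 2)) -
    2 * a * (r (‖x‖ ^ 2) / ‖x‖ ^ 2 * inner ℝ x (x - μ) * gaussK d v (‖x - μ‖ ^ 2)) with hB
  have i01 : Integrable (fun x => ‖x - μ‖ ^ 2 * gaussK d v (‖x - μ‖ ^ 2) +
    a ^ 2 * (r (‖x‖ ^ 2) / ‖x‖ ^ 2 * gaussK d v (‖x - μ‖ ^ 2))) := i0.add (i1.const_mul _)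
  have iB : Integrable B := i01.sub (i2.const_mul _)
  have hpt : ∀ x, ‖baranchik a r x - μ‖ ^ 2 * gaussK d v (‖x - μ‖ ^ 2) ≤ B x := fun x => by
    have := mul_le_mul_of_nonneg_right (norm_baranchik_sub_sq_le h01 a x μ)
      (gaussK_pos d hv (‖x - μ‖ ^ 2)).le
    simp only [hB]
    linarith
  have hBn : ∀ x, 0 ≤ B x := fun x =>
    (mul_nonneg (by positivity) (gaussK_pos d hv _).le).trans (hpt x)
  have hBint : ∫ x, B x ≤
      v * secondMoment d + a * (v₀ * m v₀) * (a * v⁻¹ - 2 * ((d : ℝ) - 2)) := by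
    have hst := stein_shrink_le hd hr h01 hv μ
    have e : ∫ x, B x = v * secondMoment d + a ^ 2 * m v - 2 * a *
        ∫ x, r (‖x‖ ^ 2) / ‖x‖ ^ 2 * inner ℝ x (x - μ) * gaussK d v (‖x - μ‖ ^ 2) := by
      rw [hB, integral_sub i01 (i2.const_mul _), integral_add i0 (i1.const_mul _),
        integral_const_mul, integral_const_mul, integral_norm_sq_mul_gaussK hv]
    have h1 : ∫ x, B x ≤ v * secondMoment d + a * ((v * m v) * (a * v⁻¹ - 2 * ((d : ℝ) - 2))) := by
      have e2 : a * ((v * m v) * (a * v⁻¹ - 2 * ((d : ℝ) - 2))) =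
          a ^ 2 * m v - 2 * a * (v * (((d : ℝ) - 2) * m v)) := by field_simp
      rw [e, e2]
      have := mul_le_mul_of_nonneg_left hst (show 0 ≤ 2 * a by positivity)
      linarith
    have h2 : (v * m v) * (a * v⁻¹ - 2 * ((d : ℝ) - 2)) ≤
        (v₀ * m v₀) * (a * v⁻¹ - 2 * ((d : ℝ) - 2)) := by
      have hzero : a * v₀⁻¹ = 2 * ((d : ℝ) - 2) := by
        rw [hv₀, inv_div]; field_simp
      rw [← hzero]
      rcases le_total v v₀ with h | h
      · refine mul_le_mul_of_nonneg_right (mul_integral_shrink_mono hd hr h01 hanti μ hv h) ?_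
        rw [sub_nonneg]
        gcongr
      · refine mul_le_mul_of_nonpos_right (mul_integral_shrink_mono hd hr h01 hanti μ hv₀pos h) ?_
        rw [sub_nonpos]
        gcongr
    have h3 := mul_le_mul_of_nonneg_left h2 ha.le
    linarith
  refine ⟨(integral_nonneg hBn).trans hBint, ?_⟩
  calc ∫⁻ x, ENNReal.ofReal (‖baranchik a r x - μ‖ ^ 2) *
        ENNReal.ofReal (gaussK d v (‖x - μ‖ ^ 2))
      ≤ ∫⁻ x, ENNReal.ofReal (B x) := lintegral_mono fun x => by
        rw [← ENNReal.ofReal_mul (by positivity)]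
        exact ENNReal.ofReal_le_ofReal (hpt x)
    _ = ENNReal.ofReal (∫ x, B x) :=
        (ofReal_integral_eq_lintegral_ofReal iB (Filter.Eventually.of_forall hBn)).symm
    _ ≤ _ := ENNReal.ofReal_le_ofReal hBint

/-- Baranchik type estimators are at least as good as `X` under squared error, for every scale
mixture of normals with the required moments. -/
lemma lintegral_baranchik_le (hd : 3 ≤ d) {Γ : Measure ℝ} (hΓ : IsMixing d Γ)
    (h1 : Integrable (fun z : ℝ => z) Γ) (h2 : Integrable (fun z : ℝ => z⁻¹) Γ)
    {r : ℝ → ℝ} (hr : Monotone r) (h01 : ∀ t, 0 ≤ r t ∧ r t ≤ 1)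
    (hanti : AntitoneOn (fun t => r t / t) (Set.Ioi 0)) {a : ℝ} (ha : 0 < a)
    (hle : a ≤ 2 * ((d : ℝ) - 2) / ∫ z, z⁻¹ ∂Γ) (μ : Vec d) :
    ∫⁻ x, ENNReal.ofReal (‖baranchik a r x - μ‖ ^ 2) ∂(locLaw (snDensity d Γ) μ) ≤
      ∫⁻ x, ENNReal.ofReal (‖x - μ‖ ^ 2) ∂(locLaw (snDensity d Γ) μ) := by
  have := hΓ.isProb
  have hb := measurable_baranchik (d := d) a hr.measurable
  obtain ⟨C, hC0, hC⟩ := exists_lintegral_baranchik_le hd hr h01 hanti ha μ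
  have hE : 0 < ∫ z, z⁻¹ ∂Γ := integral_pos_of_ae_pos (hΓ.pos.mono fun v hv => inv_pos.2 hv) h2
  rw [le_div_iff₀ hE] at hle
  have iv : Integrable (fun v => v * secondMoment d) Γ := h1.mul_const _
  have iw : Integrable (fun v => C * (a * v⁻¹ - 2 * ((d : ℝ) - 2))) Γ :=
    ((h2.const_mul a).sub (integrable_const _)).const_mul C
  have hS : 0 ≤ secondMoment d := integral_nonneg fun y =>
    mul_nonneg (by positivity) (gaussK_pos d one_pos _).le
  rw [lintegral_norm_sq_locLaw (by omega) hΓ, lintegral_locLaw hΓ μ (by fun_prop),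
    lintegral_mul_snDensity hΓ μ (by fun_prop)]
  calc _ ≤ ∫⁻ v, ENNReal.ofReal (v * secondMoment d + C * (a * v⁻¹ - 2 * ((d : ℝ) - 2))) ∂Γ :=
        lintegral_mono_ae (hΓ.pos.mono fun v hv => (hC v hv).2)
    _ = ENNReal.ofReal (∫ v, (v * secondMoment d + C * (a * v⁻¹ - 2 * ((d : ℝ) - 2))) ∂Γ) :=
        (ofReal_integral_eq_lintegral_ofReal (iv.add iw)
          (hΓ.pos.mono fun v hv => (hC v hv).1)).symm
    _ ≤ ENNReal.ofReal (∫ v, v * secondMoment d ∂Γ) := by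
        refine ENNReal.ofReal_le_ofReal ?_
        rw [integral_add iv iw, integral_const_mul, integral_sub (h2.const_mul a)
          (integrable_const _), integral_const_mul]
        simp only [integral_const, probReal_univ, one_smul]
        nlinarith
    _ = _ := ofReal_integral_eq_lintegral_ofReal iv
        (hΓ.pos.mono fun v hv => mul_nonneg hv.le hS)

/-! ### Domination by Baranchik type estimators -/

/-- Only the values of `r` on `(0, ∞)` matter, as `baranchik a r 0 = 0` in any case. -/
lemma baranchik_indicator (a : ℝ) (r : ℝ → ℝ) :
    baranchik (d := d) a ((Set.Ioi 0).indicator r) = baranchik a r := by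
  ext1 x
  rcases eq_or_ne x 0 with rfl | hx
  · simp [baranchik]
  · have : ‖x‖ ^ 2 ∈ Set.Ioi (0 : ℝ) := by
      have := norm_pos_iff.2 hx
      exact Set.mem_Ioi.2 (by positivity)
    rw [baranchik, baranchik, Set.indicator_of_mem this]

/-- Far from the origin a nontrivial Baranchik type estimator shrinks by a factor in `(-1, 1)`. -/
lemma not_ae_norm_baranchik_eq (hd : 1 ≤ d) {r : ℝ → ℝ} (hr : Monotone r)
    (h01 : ∀ t, 0 ≤ r t ∧ r t ≤ 1) (hne : ∃ t, 0 < t ∧ r t ≠ 0) {a : ℝ} (ha : 0 < a) :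
    ¬ ∀ᵐ x : Vec d, ‖baranchik a r x - 0‖ ^ 2 = ‖x - 0‖ ^ 2 := by
  intro hae
  have : Nonempty (Fin d) := ⟨⟨0, hd⟩⟩
  obtain ⟨t, ht, hrt⟩ := hne
  obtain ⟨x₀, hx₀⟩ := NormedSpace.exists_lt_norm ℝ (Vec d) (t + a + 1)
  obtain ⟨x, hxe, hx⟩ := (Measure.dense_of_ae hae).exists_mem_open
    (U := {x : Vec d | t + a + 1 < ‖x‖}) (isOpen_lt continuous_const continuous_norm) ⟨x₀, hx₀⟩
  simp only [Set.mem_ofPred_eq, sub_zero] at hx hxe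
  have hsq : t + a + 1 < ‖x‖ ^ 2 := by nlinarith
  have hx0 : 0 < ‖x‖ ^ 2 := by linarith
  have hrx : 0 < r (‖x‖ ^ 2) :=
    (lt_of_le_of_ne (h01 t).1 hrt.symm).trans_le (hr (by linarith))
  have hc0 : 0 < a * (r (‖x‖ ^ 2) / ‖x‖ ^ 2) := by positivity
  have hc1 : a * (r (‖x‖ ^ 2) / ‖x‖ ^ 2) < 1 := by
    rw [mul_div_assoc', div_lt_one hx0]
    nlinarith [(h01 (‖x‖ ^ 2)).2]
  rw [baranchik, norm_smul, mul_pow, Real.norm_eq_abs, sq_abs] at hxe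
  nlinarith [mul_pos hc0 (sub_pos.2 hc1), mul_pos (mul_pos hc0 (sub_pos.2 hc1)) hx0,
    mul_pos hc0 hx0]

lemma dominates_l2Risk_baranchik (hd : 3 ≤ d) {G H : Measure ℝ} (hG : IsMixing d G)
    (hH : IsMixing d H) (h1 : Integrable (fun z : ℝ => z) (mixZ d G H))
    (h2 : Integrable (fun z : ℝ => z⁻¹) (mixZ d G H)) {r : ℝ → ℝ} {a : ℝ}
    (hr : MonotoneOn r (Set.Ioi 0)) (hanti : AntitoneOn (fun t => r t / t) (Set.Ioi 0))
    (h01 : ∀ t, 0 < t → 0 ≤ r t ∧ r t ≤ 1) (hne : ∃ t, 0 < t ∧ r t ≠ 0)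
    (ha : 0 < a) (hle : a ≤ 2 * ((d : ℝ) - 2) / ∫ z, z⁻¹ ∂(mixZ d G H)) :
    Dominates
      (l2Risk (snDensity d G) (snDensity d H) (plugIn (snDensity d (mixF G H)) (baranchik a r)))
      (l2Risk (snDensity d G) (snDensity d H) (plugIn (snDensity d (mixF G H)) id)) := by
  have hd1 : 1 ≤ d := by omega
  obtain ⟨r', hr'⟩ : ∃ r', r' = (Set.Ioi 0).indicator r := ⟨_, rfl⟩
  have hpos : ∀ {t}, 0 < t → r' t = r t := fun ht => by
    rw [hr', Set.indicator_of_mem (Set.mem_Ioi.2 ht)]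
  have hneg : ∀ {t}, t ≤ 0 → r' t = 0 := fun ht => by
    rw [hr', Set.indicator_of_notMem (by simpa using ht)]
  have h01' : ∀ t, 0 ≤ r' t ∧ r' t ≤ 1 := fun t => by
    rcases le_or_gt t 0 with ht | ht
    · rw [hneg ht]; norm_num
    · rw [hpos ht]; exact h01 t ht
  have hmono : Monotone r' := fun s t hst => by
    rcases le_or_gt s 0 with hs | hs
    · rw [hneg hs]; exact (h01' t).1
    · rw [hpos hs, hpos (hs.trans_le hst)]
      exact hr hs (hs.trans_le hst) hst
  have hanti' : AntitoneOn (fun t => r' t / t) (Set.Ioi 0) := hanti.congr fun t ht => by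
    simp only [hpos ht]
  have hne' : ∃ t, 0 < t ∧ r' t ≠ 0 := by
    obtain ⟨t, ht, h⟩ := hne
    exact ⟨t, ht, by rwa [hpos ht]⟩
  rw [← baranchik_indicator a r, ← hr']
  have hb := measurable_baranchik (d := d) a hmono.measurable
  have key := fun μ => overlap_le_of_sq_risk_le hd1 hG hH hb μ (lintegral_baranchik_le hd
    (isMixing_mixZ hd1 hG hH) h1 h2 hmono h01' hanti' ha hle μ)
  rw [dominates_l2Risk_plugIn_iff hd1 hG hH hb measurable_id]
  refine ⟨fun μ => (key μ).1, 0, lt_of_le_of_ne (key 0).1 fun heq => ?_⟩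
  -- at the largest admissible `a` the squared error risks may coincide, so strictness comes from
  -- the strict convexity of the loss
  exact not_ae_norm_baranchik_eq hd1 hmono h01' hne' ha ((key 0).2 heq.symm)

/-- The case `r = 1` of the Baranchik type estimators, the James–Stein estimator, dominates. -/
lemma inadmissible_plugIn_id (hd : 3 ≤ d) {G H : Measure ℝ} (hG : IsMixing d G)
    (hH : IsMixing d H) (h1 : Integrable (fun z : ℝ => z) (mixZ d G H))
    (h2 : Integrable (fun z : ℝ => z⁻¹) (mixZ d G H)) :
    Inadmissible (snDensity d G) (snDensity d H) (plugIn (snDensity d (mixF G H)) id) := by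
  have hd1 : 1 ≤ d := by omega
  have hd' : (0 : ℝ) < (d : ℝ) - 2 := by
    have : (3 : ℝ) ≤ d := by exact_mod_cast hd
    linarith
  have := (isMixing_mixZ hd1 hG hH).isProb
  have hE : 0 < ∫ z, z⁻¹ ∂(mixZ d G H) :=
    integral_pos_of_ae_pos ((ae_mixZ_pos hG hH).mono fun v hv => inv_pos.2 hv) h2
  refine ⟨_, isPredictiveDensity_plugIn hd1 (hG.conv hH)
    (measurable_baranchik (2 * ((d : ℝ) - 2) / ∫ z, z⁻¹ ∂(mixZ d G H)) (measurable_const (a := 1))),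
    dominates_l2Risk_baranchik hd hG hH h1 h2 monotoneOn_const ?_ (fun t _ => by norm_num)
      ⟨1, one_pos, one_ne_zero⟩ (by positivity) le_rfl⟩
  intro s hs t _ hst
  exact one_div_le_one_div_of_le hs hst

end Baranchik

end PredDensity

end

theorem theorem4p1 (d : ℕ) (hd : 1 ≤ d) (G H : Measure ℝ) (p q : Vec d → ℝ)
    (hp : IsSN p G) (hq : IsSN q H) :
    -- the setting: `q * p ∼ SN(F)`, its location shift by `X` is the MRE estimator, and `F_Z` is a
    -- genuine mixing distribution
    (IsSN (convDensity q p) (mixF G H) ∧ IsMRE p q (plugIn (convDensity q p) id) ∧ IsMixing d (mixZ d G H)) ∧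
    -- (a)
    (∀ muhat : Vec d → Vec d, Measurable muhat → ∀ K : ℝ,
      (Dominates (l2Risk p q (plugIn (convDensity q p) muhat)) (l2Risk p q (plugIn (convDensity q p) id)) ↔
        Dominates (pointRisk p (reflectedLoss d (mixJ G H) K) muhat)
          (pointRisk p (reflectedLoss d (mixJ G H) K) id))) ∧
    -- (b)
    (∀ muhat : Vec d → Vec d, Measurable muhat →
      Dominates (pointRisk (snDensity d (mixZ d G H)) (fun s => s) muhat)
        (pointRisk (snDensity d (mixZ d G H)) (fun s => s) id) →
      Dominates (l2Risk p q (plugIn (convDensity q p) muhat)) (l2Risk p q (plugIn (convDensity q p) id))) ∧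
    -- (c)
    (3 ≤ d → Integrable (fun z : ℝ => z) (mixZ d G H) →
      Integrable (fun z : ℝ => z⁻¹) (mixZ d G H) →
      Inadmissible p q (plugIn (convDensity q p) id) ∧
      ∀ (r : ℝ → ℝ) (a : ℝ),
        MonotoneOn r (Set.Ioi 0) → AntitoneOn (fun t => r t / t) (Set.Ioi 0) →
        (∀ t, 0 < t → 0 ≤ r t ∧ r t ≤ 1) → (∃ t, 0 < t ∧ r t ≠ 0) →
        0 < a → a ≤ 2 * ((d : ℝ) - 2) / ∫ z, z⁻¹ ∂(mixZ d G H) →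
        Dominates (l2Risk p q (plugIn (convDensity q p) (baranchik a r)))
          (l2Risk p q (plugIn (convDensity q p) id))) := by
  obtain ⟨hG, rfl⟩ := hp
  obtain ⟨hH, rfl⟩ := hq
  have := hG.isProb
  have := hH.isProb
  have hconv : convDensity (snDensity d H) (snDensity d G) = snDensity d (mixF G H) := by
    rw [convDensity_snDensity hd hH hG, Measure.conv_comm, mixF_eq]
  rw [hconv]
  refine ⟨⟨⟨hG.conv hH, rfl⟩, isMRE_plugIn hd hG hH, isMixing_mixZ hd hG hH⟩, ?_, ?_, ?_⟩
  · intro muhat hm K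
    rw [dominates_l2Risk_plugIn_iff hd hG hH hm measurable_id,
      dominates_pointRisk_reflectedLoss_iff hd hG hH K hm measurable_id]
  · intro muhat hm hdom
    exact dominates_l2Risk_of_dominates_sq hd hG hH hm hdom
  · intro hd3 h1 h2
    exact ⟨inadmissible_plugIn_id hd3 hG hH h1 h2, fun r a hr hanti h01 hne ha hle =>
      dominates_l2Risk_baranchik hd3 hG hH h1 h2 hr hanti h01 hne ha hle⟩
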